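/- An $r$-matrix is a matrix with entries in $\{0,1,\dots,r-1\}$; a matrix is simple if its columns are pairwise distinct; a matrix $A$ avoids a matrix $F$ if no submatrix of $A$ is a row and column permutation of $F$. Let $\mathrm{forb}(m,r,F)$ be the maximum number of columns of a simple $m$-rowed $r$-matrix that avoids $F$, and let $$M=\begin{bmatrix}0&1\\0&1\\1&0\end{bmatrix}.$$ A triangular choice multigraph (TCM) on a finite set $V$ is a multigraph obtained from the empty graph on $V$ by choosing, for every unordered triple of distinct vertices $u,v,w\in V$, exactly one of the edges $uv,uw,vw$ and adding a copy of it. The 2-recursive TCMs are defined recursively: if $|V|\le 2$, the empty graph on $V$ is 2-recursive; if $|V|\ge 3$, a TCM $\mathcal G$ on $V$ is 2-recursive if there are a partition $V=V_1\cup V_2$ into two non-empty disjoint sets and 2-recursive TCMs $\mathcal G_1$ on $V_1$ and $\mathcal G_2$ on $V_2$ such that $\mathcal G=\mathcal G_1\cup\mathcal G_2\cup\mathcal G_3$ (union with edge multiplicities), where $\mathcal G_3$ has one copy of $uv$ for every pair $\{u,v\}\subseteq V_1$ and every $w\in V_2$, and one copy of $vw$ for every $u\in V_1$ and every pair $\{v,w\}\subseteq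 V_2$. For a TCM $\mathcal G$ on $[m]=\{1,\dots,m\}$ let $m^{\mathcal G}_{xy}$ be the multiplicity of the edge $xy$, and for $\alpha\in\mathbb R$ let $w(\mathcal G,\alpha)=\sum_{xy}\alpha^{m^{\mathcal G}_{xy}}$, the sum being over all $\binom m2$ unordered pairs of distinct elements of $[m]$ (including those of multiplicity $0$). Let $H(m,\alpha)$ be the maximum of $w(\mathcal G,\alpha)$ over all TCMs $\mathcal G$ on $[m]$, and $H_2(m,\alpha)$ the maximum over all 2-recursive TCMs on $[m]$. Theorem. For all integers $m\ge 0$ and $r\ge 3$, $$H_2\!\left(m,\tfrac{r-1}{r-2}\right)(r-2)^{m-2}\;\le\;\mathrm{forb}(m,r,M)-(r-1)^m-m(r-1)^{m-1}\;\le\; H\!\left(m,\tfrac{r-1}{r-2}\right)(r-2)^{m-2}.$$ -/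

import Mathlib

namespace ForbConfig

/-! ### Forbidden configurations -/

/-- An `r`-matrix is a matrix all of whose entries lie in `{0, 1, ..., r - 1}`. -/
def IsRMatrix (r : ℕ) {m n : ℕ} (A : Matrix (Fin m) (Fin n) ℕ) : Prop :=
  ∀ i j, A i j < r

/-- A matrix is simple if its columns are pairwise distinct. -/
def IsSimple {m n : ℕ} (A : Matrix (Fin m) (Fin n) ℕ) : Prop :=
  ∀ j j' : Fin n, (∀ i, A i j = A i j') → j = j'

/-- `F ≺ A`: some submatrix of `A` is a row and column permutation of `F`, i.e. `F` is read off
from `A` along pairwise distinct rows and pairwise distinct columns, listed in any order. -/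
def HasConfiguration {k l m n : ℕ} (F : Matrix (Fin k) (Fin l) ℕ)
    (A : Matrix (Fin m) (Fin n) ℕ) : Prop :=
  ∃ (f : Fin k → Fin m) (g : Fin l → Fin n),
    Function.Injective f ∧ Function.Injective g ∧ ∀ i j, A (f i) (g j) = F i j

/-- The numbers of columns of the simple `m`-rowed `r`-matrices that avoid `F`. -/
def avoidSizes (m r : ℕ) {k l : ℕ} (F : Matrix (Fin k) (Fin l) ℕ) : Set ℕ :=
  {n | ∃ A : Matrix (Fin m) (Fin n) ℕ, IsRMatrix r A ∧ IsSimple A ∧ ¬ HasConfiguration F A}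

/-- `forb(m, r, F)`: the maximum number of columns of a simple `m`-rowed `r`-matrix that
avoids `F`. -/
noncomputable def forb (m r : ℕ) {k l : ℕ} (F : Matrix (Fin k) (Fin l) ℕ) : ℕ :=
  sSup (avoidSizes m r F)

/-- The matrix `M`. -/
def M : Matrix (Fin 3) (Fin 2) ℕ :=
  !![0, 1;
     0, 1;
     1, 0]

/-! ### Triangular choice multigraphs

A multigraph is the multiset of its edges, an edge being an unordered pair of distinct vertices. -/

section Multigraph

variable {W : Type*} [DecidableEq W]

/-- The edges of the complete graph on the finite vertex set `V`. -/
def edgesOn (V : Finset W) : Finset (Sym2 W) :=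
  V.sym2.filter fun e => ¬ e.IsDiag

/-- `G` is a triangular choice multigraph on `V`: it consists of one edge `c T` of each
three-element subset `T` of `V`. -/
def IsTCM (V : Finset W) (G : Multiset (Sym2 W)) : Prop :=
  ∃ c : {T : Finset W // T ∈ V.powersetCard 3} → Sym2 W,
    (∀ T, c T ∈ edgesOn T.1) ∧ G = (V.powersetCard 3).attach.val.map c

/-- The multigraph which, for two disjoint vertex sets `V₁`, `V₂`, has one copy of `uv` for each
pair `u, v` in `V₁` and each `w` in `V₂`, and one copy of `vw` for each `u` in `V₁` and each pair
`v, w` in `V₂`. -/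
def crossing (V₁ V₂ : Finset W) : Multiset (Sym2 W) :=
  (edgesOn V₁ ×ˢ V₂).val.map Prod.fst + (V₁ ×ˢ edgesOn V₂).val.map Prod.snd

/-- `G` is a 2-recursive triangular choice multigraph on `V`. (That it is a triangular choice
multigraph is proved below.) On the empty vertex set, the empty multigraph counts as
2-recursive. -/
inductive IsTwoRecursive : Finset W → Multiset (Sym2 W) → Prop
  | small (V : Finset W) (hV : V.card ≤ 2) : IsTwoRecursive V 0
  | split (V₁ V₂ : Finset W) (G₁ G₂ : Multiset (Sym2 W)) (hd : Disjoint V₁ V₂)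
      (h₁ : V₁.Nonempty) (h₂ : V₂.Nonempty) (hcard : 3 ≤ (V₁ ∪ V₂).card)
      (hG₁ : IsTwoRecursive V₁ G₁) (hG₂ : IsTwoRecursive V₂ G₂) :
      IsTwoRecursive (V₁ ∪ V₂) (G₁ + G₂ + crossing V₁ V₂)

/-- `w(G, α)`: the sum of `α ^ m_e` over all edges `e` of the complete graph on `V`, where `m_e`
is the multiplicity of `e` in `G`. -/
noncomputable def weight (V : Finset W) (G : Multiset (Sym2 W)) (α : ℝ) : ℝ :=
  ∑ e ∈ edgesOn V, α ^ G.count e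

end Multigraph

/-- The weights of the triangular choice multigraphs on `m` vertices. -/
def tcmWeights (m : ℕ) (α : ℝ) : Set ℝ :=
  {x | ∃ G : Multiset (Sym2 (Fin m)), IsTCM Finset.univ G ∧ x = weight Finset.univ G α}

/-- The weights of the 2-recursive triangular choice multigraphs on `m` vertices. -/
def twoRecursiveWeights (m : ℕ) (α : ℝ) : Set ℝ :=
  {x | ∃ G : Multiset (Sym2 (Fin m)), IsTwoRecursive Finset.univ G ∧
    x = weight Finset.univ G α}

/-- `H(m, α)`. -/
noncomputable def H (m : ℕ) (α : ℝ) : ℝ := sSup (tcmWeights m α)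

/-- `H₂(m, α)`. -/
noncomputable def H₂ (m : ℕ) (α : ℝ) : ℝ := sSup (twoRecursiveWeights m α)

/-! ### The maxima above are attained -/

theorem forb_isGreatest (m r : ℕ) {k l : ℕ} (hl : 0 < l) (F : Matrix (Fin k) (Fin l) ℕ) :
    IsGreatest (avoidSizes m r F) (forb m r F) := by
  have hne : (avoidSizes m r F).Nonempty := by
    refine ⟨0, fun _ j => j.elim0, fun _ j => j.elim0, fun j => j.elim0, ?_⟩
    rintro ⟨_, g, _⟩
    exact (g ⟨0, hl⟩).elim0
  have hbdd : BddAbove (avoidSizes m r F) := by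
    refine ⟨r ^ m, ?_⟩
    rintro n ⟨A, hA, hs, _⟩
    have hinj : Function.Injective
        (fun (j : Fin n) (i : Fin m) => (⟨A i j, hA i j⟩ : Fin r)) := by
      intro j j' h
      refine hs j j' fun i => ?_
      exact congrArg Fin.val (congrFun h i)
    simpa using Fintype.card_le_of_injective _ hinj
  exact ⟨Nat.sSup_mem hne hbdd, fun n hn => le_csSup hbdd hn⟩

section Multigraph

variable {W : Type*} [DecidableEq W]

theorem mk_mem_edgesOn {V : Finset W} {a b : W} :
    s(a, b) ∈ edgesOn V ↔ a ∈ V ∧ b ∈ V ∧ a ≠ b := by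
  simp [edgesOn, and_assoc]

theorem isTCM_iff [Nonempty W] {V : Finset W} {G : Multiset (Sym2 W)} :
    IsTCM V G ↔ ∃ c : Finset W → Sym2 W,
      (∀ T ∈ V.powersetCard 3, c T ∈ edgesOn T) ∧ G = (V.powersetCard 3).val.map c := by
  have key : (V.powersetCard 3).val = (V.powersetCard 3).attach.val.map Subtype.val :=
    (Multiset.attach_map_val _).symm
  constructor
  · rintro ⟨c, hc, rfl⟩
    obtain ⟨a⟩ := ‹Nonempty W›
    refine ⟨fun T => if h : T ∈ V.powersetCard 3 then c ⟨T, h⟩ else s(a, a), ?_, ?_⟩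
    · intro T hT
      simpa only [dif_pos hT] using hc ⟨T, hT⟩
    · refine Eq.trans ?_ (congrArg (Multiset.map _) key).symm
      rw [Multiset.map_map]
      refine Multiset.map_congr rfl fun T _ => ?_
      simp only [Function.comp, dif_pos T.2]
  · rintro ⟨c, hc, rfl⟩
    refine ⟨fun T => c T.1, fun T => hc T.1 T.2, ?_⟩
    rw [key, Multiset.map_map]
    rfl

/-- The triples inside `V₁ ∪ V₂` are those inside `V₁`, those inside `V₂`, and those with two
elements in one part and one in the other. -/
theorem powersetCard_three_union {V₁ V₂ : Finset W} (hd : Disjoint V₁ V₂) :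
    ((V₁ ∪ V₂).powersetCard 3).val =
      (V₁.powersetCard 3).val + (V₂.powersetCard 3).val +
        ((edgesOn V₁ ×ˢ V₂).val.map (fun p => insert p.2 p.1.toFinset) +
          (V₁ ×ˢ edgesOn V₂).val.map (fun p => insert p.1 p.2.toFinset)) := by
  have hdis : ∀ x, x ∈ V₁ → x ∈ V₂ → False := fun x h h' => Finset.disjoint_left.1 hd h h'
  have hQ₁ : ∀ T, T ∈ (edgesOn V₁ ×ˢ V₂).val.map (fun p => insert p.2 p.1.toFinset) ↔
      ∃ a b w, a ∈ V₁ ∧ b ∈ V₁ ∧ a ≠ b ∧ w ∈ V₂ ∧ T = {w, a, b} := by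
    intro T
    simp only [Multiset.mem_map, Finset.mem_val, Finset.mem_product]
    constructor
    · rintro ⟨⟨e, w⟩, ⟨he, hw⟩, rfl⟩
      induction e with | _ a b =>
      obtain ⟨ha, hb, hab⟩ := mk_mem_edgesOn.1 he
      exact ⟨a, b, w, ha, hb, hab, hw, by simp [Sym2.toFinset_mk_eq]⟩
    · rintro ⟨a, b, w, ha, hb, hab, hw, rfl⟩
      exact ⟨(s(a, b), w), ⟨mk_mem_edgesOn.2 ⟨ha, hb, hab⟩, hw⟩, by simp [Sym2.toFinset_mk_eq]⟩
  have hQ₂ : ∀ T, T ∈ (V₁ ×ˢ edgesOn V₂).val.map (fun p => insert p.1 p.2.toFinset) ↔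
      ∃ a b w, a ∈ V₂ ∧ b ∈ V₂ ∧ a ≠ b ∧ w ∈ V₁ ∧ T = {w, a, b} := by
    intro T
    simp only [Multiset.mem_map, Finset.mem_val, Finset.mem_product]
    constructor
    · rintro ⟨⟨w, e⟩, ⟨hw, he⟩, rfl⟩
      induction e with | _ a b =>
      obtain ⟨ha, hb, hab⟩ := mk_mem_edgesOn.1 he
      exact ⟨a, b, w, ha, hb, hab, hw, by simp [Sym2.toFinset_mk_eq]⟩
    · rintro ⟨a, b, w, ha, hb, hab, hw, rfl⟩
      exact ⟨(w, s(a, b)), ⟨hw, mk_mem_edgesOn.2 ⟨ha, hb, hab⟩⟩, by simp [Sym2.toFinset_mk_eq]⟩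
  refine (Multiset.Nodup.ext (Finset.nodup _) ?_).2 ?_
  · rw [Multiset.nodup_add, Multiset.nodup_add, Multiset.nodup_add]
    refine ⟨⟨Finset.nodup _, Finset.nodup _, ?_⟩, ⟨?_, ?_, ?_⟩, ?_⟩
    · rw [Multiset.disjoint_left]
      intro T h h'
      simp only [Finset.mem_val, Finset.mem_powersetCard] at h h'
      obtain ⟨x, hx⟩ : T.Nonempty := by rw [← Finset.card_pos]; omega
      exact hdis x (h.1 hx) (h'.1 hx)
    · refine Multiset.Nodup.map_on ?_ (Finset.nodup _)
      rintro ⟨e, w⟩ he ⟨e', w'⟩ he' h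
      simp only [Finset.mem_val, Finset.mem_product] at he he' h
      induction e with | _ a b =>
      induction e' with | _ a' b' =>
      rw [mk_mem_edgesOn] at he he'
      simp only [Sym2.toFinset_mk_eq, Finset.ext_iff, Finset.mem_insert,
        Finset.mem_singleton] at h
      have i₁ := h a
      have i₂ := h b
      have i₃ := h w
      have i₄ := h a'
      have i₅ := h b'
      have i₆ := h w'
      clear h hQ₁ hQ₂
      simp only [Prod.mk.injEq, Sym2.eq_iff]
      grind
    · refine Multiset.Nodup.map_on ?_ (Finset.nodup _)
      rintro ⟨w, e⟩ he ⟨w', e'⟩ he' h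
      simp only [Finset.mem_val, Finset.mem_product] at he he' h
      induction e with | _ a b =>
      induction e' with | _ a' b' =>
      rw [mk_mem_edgesOn] at he he'
      simp only [Sym2.toFinset_mk_eq, Finset.ext_iff, Finset.mem_insert,
        Finset.mem_singleton] at h
      have i₁ := h a
      have i₂ := h b
      have i₃ := h w
      have i₄ := h a'
      have i₅ := h b'
      have i₆ := h w'
      clear h hQ₁ hQ₂
      simp only [Prod.mk.injEq, Sym2.eq_iff]
      grind
    · rw [Multiset.disjoint_left]
      intro T h h'
      obtain ⟨a, b, w, ha, hb, hab, hw, rfl⟩ := (hQ₁ T).1 h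
      obtain ⟨a', b', w', ha', hb', hab', hw', h⟩ := (hQ₂ _).1 h'
      simp only [Finset.ext_iff, Finset.mem_insert, Finset.mem_singleton] at h
      have i₁ := h a
      have i₂ := h b
      clear h h' hQ₁ hQ₂
      grind
    · rw [Multiset.disjoint_left]
      intro T h h'
      rw [Multiset.mem_add, hQ₁, hQ₂] at h'
      simp only [Multiset.mem_add, Finset.mem_val, Finset.mem_powersetCard,
        Finset.subset_iff] at h
      grind
  · intro T
    rw [Multiset.mem_add, Multiset.mem_add, Multiset.mem_add, hQ₁, hQ₂]
    simp only [Finset.mem_val, Finset.mem_powersetCard]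
    constructor
    · rintro ⟨hT, hc⟩
      obtain ⟨x, y, z, hxy, hxz, hyz, rfl⟩ := Finset.card_eq_three.1 hc
      have hx := hT (by simp : x ∈ _)
      have hy := hT (by simp : y ∈ _)
      have hz := hT (by simp : z ∈ _)
      rw [Finset.mem_union] at hx hy hz
      rcases hx with hx | hx <;> rcases hy with hy | hy <;> rcases hz with hz | hz
      · exact .inl (.inl ⟨by simp [Finset.insert_subset_iff, *], hc⟩)
      · exact .inr (.inl ⟨x, y, z, hx, hy, hxy, hz, by grind⟩)
      · exact .inr (.inl ⟨x, z, y, hx, hz, hxz, hy, by grind⟩)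
      · exact .inr (.inr ⟨y, z, x, hy, hz, hyz, hx, by grind⟩)
      · exact .inr (.inl ⟨y, z, x, hy, hz, hyz, hx, by grind⟩)
      · exact .inr (.inr ⟨x, z, y, hx, hz, hxz, hy, by grind⟩)
      · exact .inr (.inr ⟨x, y, z, hx, hy, hxy, hz, by grind⟩)
      · exact .inl (.inr ⟨by simp [Finset.insert_subset_iff, *], hc⟩)
    · rintro ((⟨h, hc⟩ | ⟨h, hc⟩) | ⟨a, b, w, ha, hb, hab, hw, rfl⟩ |
        ⟨a, b, w, ha, hb, hab, hw, rfl⟩)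
      · exact ⟨h.trans Finset.subset_union_left, hc⟩
      · exact ⟨h.trans Finset.subset_union_right, hc⟩
      · refine ⟨by simp [Finset.insert_subset_iff, *], Finset.card_eq_three.2
          ⟨w, a, b, ?_, ?_, hab, rfl⟩⟩ <;> grind
      · refine ⟨by simp [Finset.insert_subset_iff, *], Finset.card_eq_three.2
          ⟨w, a, b, ?_, ?_, hab, rfl⟩⟩ <;> grind

theorem IsTwoRecursive.isTCM {V : Finset W} {G : Multiset (Sym2 W)}
    (h : IsTwoRecursive V G) : IsTCM V G := by
  induction h with
  | small V hV =>
    have hP : V.powersetCard 3 = ∅ := Finset.powersetCard_eq_empty.2 (by omega)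
    have hs : ∀ T : Finset W, T ∈ V.powersetCard 3 → False := by simp [hP]
    refine ⟨fun T => (hs T.1 T.2).elim, fun T => (hs T.1 T.2).elim, ?_⟩
    rw [Finset.attach_eq_empty_iff.2 hP]
    rfl
  | split V₁ V₂ G₁ G₂ hd h₁ h₂ hcard hG₁ hG₂ ih₁ ih₂ =>
    classical
    have hne : Nonempty W := ⟨h₁.choose⟩
    have hdis : ∀ x, x ∈ V₁ → x ∈ V₂ → False := fun x h h' => Finset.disjoint_left.1 hd h h'
    rw [isTCM_iff] at ih₁ ih₂ ⊢
    obtain ⟨c₁, hc₁, rfl⟩ := ih₁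
    obtain ⟨c₂, hc₂, rfl⟩ := ih₂
    obtain ⟨d, hcross⟩ : ∃ d : Finset W → Sym2 W,
        ∀ T e, e ∈ edgesOn T → (e ∈ edgesOn V₁ ∨ e ∈ edgesOn V₂) →
          (∀ e', e' ∈ edgesOn T → (e' ∈ edgesOn V₁ ∨ e' ∈ edgesOn V₂) → e' = e) → d T = e := by
      refine ⟨fun T => if h : ∃ e, e ∈ edgesOn T ∧ (e ∈ edgesOn V₁ ∨ e ∈ edgesOn V₂)
        then h.choose else s(hne.some, hne.some), ?_⟩
      intro T e he hV hu
      have h : ∃ e, e ∈ edgesOn T ∧ (e ∈ edgesOn V₁ ∨ e ∈ edgesOn V₂) := ⟨e, he, hV⟩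
      simp only [dif_pos h]
      exact hu _ h.choose_spec.1 h.choose_spec.2
    set c : Finset W → Sym2 W := fun T => if T ⊆ V₁ then c₁ T else if T ⊆ V₂ then c₂ T else d T
      with hc
    have e₁ : ∀ T ∈ (V₁.powersetCard 3).val, c₁ T = c T := by
      intro T hT
      have hT' := (Finset.mem_powersetCard.1 hT).1
      simp only [hc, if_pos hT']
    have e₂ : ∀ T ∈ (V₂.powersetCard 3).val, c₂ T = c T := by
      intro T hT
      obtain ⟨hT', h3⟩ := Finset.mem_powersetCard.1 hT
      have hn : ¬ T ⊆ V₁ := by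
        intro h
        obtain ⟨x, hx⟩ : T.Nonempty := by rw [← Finset.card_pos]; omega
        exact hdis x (h hx) (hT' hx)
      simp only [hc, if_neg hn, if_pos hT']
    have e₃ : ∀ p ∈ (edgesOn V₁ ×ˢ V₂).val,
        p.1 ∈ edgesOn (insert p.2 p.1.toFinset) ∧ p.1 = c (insert p.2 p.1.toFinset) := by
      rintro ⟨e, w⟩ hp
      obtain ⟨he, hw⟩ := Finset.mem_product.1 hp
      induction e with | _ a b =>
      have hab := mk_mem_edgesOn.1 he
      have hm : s(a, b) ∈ edgesOn (insert w s(a, b).toFinset) :=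
        mk_mem_edgesOn.2 ⟨by simp, by simp, hab.2.2⟩
      have hn₁ : ¬ insert w s(a, b).toFinset ⊆ V₁ := fun h => hdis w (h (by simp)) hw
      have hn₂ : ¬ insert w s(a, b).toFinset ⊆ V₂ := fun h => hdis a hab.1 (h (by simp))
      refine ⟨hm, ?_⟩
      simp only [hc, if_neg hn₁, if_neg hn₂]
      refine (hcross _ _ hm (.inl he) ?_).symm
      intro e' h' hV
      induction e' with | _ x y =>
      simp only [mk_mem_edgesOn, Sym2.toFinset_mk_eq, Finset.mem_insert,
        Finset.mem_singleton] at h' hV he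
      rw [Sym2.eq_iff]
      grind
    have e₄ : ∀ p ∈ (V₁ ×ˢ edgesOn V₂).val,
        p.2 ∈ edgesOn (insert p.1 p.2.toFinset) ∧ p.2 = c (insert p.1 p.2.toFinset) := by
      rintro ⟨w, e⟩ hp
      obtain ⟨hw, he⟩ := Finset.mem_product.1 hp
      induction e with | _ a b =>
      have hab := mk_mem_edgesOn.1 he
      have hm : s(a, b) ∈ edgesOn (insert w s(a, b).toFinset) :=
        mk_mem_edgesOn.2 ⟨by simp, by simp, hab.2.2⟩
      have hn₁ : ¬ insert w s(a, b).toFinset ⊆ V₁ := fun h => hdis a (h (by simp)) hab.1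
      have hn₂ : ¬ insert w s(a, b).toFinset ⊆ V₂ := fun h => hdis w hw (h (by simp))
      refine ⟨hm, ?_⟩
      simp only [hc, if_neg hn₁, if_neg hn₂]
      refine (hcross _ _ hm (.inr he) ?_).symm
      intro e' h' hV
      induction e' with | _ x y =>
      simp only [mk_mem_edgesOn, Sym2.toFinset_mk_eq, Finset.mem_insert,
        Finset.mem_singleton] at h' hV he
      rw [Sym2.eq_iff]
      grind
    refine ⟨c, ?_, ?_⟩
    · intro T hT
      rw [← Finset.mem_val, powersetCard_three_union hd, Multiset.mem_add, Multiset.mem_add,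
        Multiset.mem_add, Multiset.mem_map, Multiset.mem_map] at hT
      rcases hT with (hT | hT) | ⟨p, hp, rfl⟩ | ⟨p, hp, rfl⟩
      · exact e₁ T hT ▸ hc₁ T hT
      · exact e₂ T hT ▸ hc₂ T hT
      · exact (e₃ p hp).2 ▸ (e₃ p hp).1
      · exact (e₄ p hp).2 ▸ (e₄ p hp).1
    · rw [powersetCard_three_union hd, Multiset.map_add, Multiset.map_add, Multiset.map_add,
        Multiset.map_map, Multiset.map_map, crossing,
        Multiset.map_congr rfl e₁, Multiset.map_congr rfl e₂,
        Multiset.map_congr rfl fun p hp => (e₃ p hp).2,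
        Multiset.map_congr rfl fun p hp => (e₄ p hp).2]
      rfl

theorem exists_isTwoRecursive (V : Finset W) : ∃ G, IsTwoRecursive V G := by
  induction V using Finset.strongInduction with
  | H V ih =>
    by_cases hV : V.card ≤ 2
    · exact ⟨0, .small V hV⟩
    · obtain ⟨a, ha⟩ : V.Nonempty := by
        rw [← Finset.card_pos]; omega
      have hne : (V.erase a).Nonempty := by
        rw [← Finset.card_pos, Finset.card_erase_of_mem ha]; omega
      obtain ⟨G₁, hG₁⟩ := ih (V.erase a) (Finset.erase_ssubset ha)
      have hu : V.erase a ∪ {a} = V := by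
        ext x; by_cases hx : x = a <;> simp [hx, ha]
      have := IsTwoRecursive.split (V.erase a) {a} G₁ 0 (by simp) hne (by simp)
        (by rw [hu]; omega) hG₁ (.small {a} (by simp))
      rw [hu] at this
      exact ⟨_, this⟩

end Multigraph

theorem finite_tcmWeights (m : ℕ) (α : ℝ) : (tcmWeights m α).Finite := by
  refine (Set.finite_range
    fun c : {T : Finset (Fin m) // T ∈ Finset.univ.powersetCard 3} → Sym2 (Fin m) =>
      weight Finset.univ ((Finset.univ.powersetCard 3).attach.val.map c) α).subset ?_
  rintro x ⟨G, ⟨c, _, rfl⟩, rfl⟩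
  exact ⟨c, rfl⟩

theorem twoRecursiveWeights_subset (m : ℕ) (α : ℝ) :
    twoRecursiveWeights m α ⊆ tcmWeights m α := by
  rintro x ⟨G, hG, rfl⟩
  exact ⟨G, hG.isTCM, rfl⟩

theorem twoRecursiveWeights_nonempty (m : ℕ) (α : ℝ) : (twoRecursiveWeights m α).Nonempty := by
  obtain ⟨G, hG⟩ := exists_isTwoRecursive (Finset.univ : Finset (Fin m))
  exact ⟨_, G, hG, rfl⟩

theorem H_isGreatest (m : ℕ) (α : ℝ) : IsGreatest (tcmWeights m α) (H m α) :=
  have hf := finite_tcmWeights m α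
  ⟨((twoRecursiveWeights_nonempty m α).mono (twoRecursiveWeights_subset m α)).csSup_mem hf,
    fun _ hx => le_csSup hf.bddAbove hx⟩

theorem H₂_isGreatest (m : ℕ) (α : ℝ) : IsGreatest (twoRecursiveWeights m α) (H₂ m α) :=
  have hf := (finite_tcmWeights m α).subset (twoRecursiveWeights_subset m α)
  ⟨(twoRecursiveWeights_nonempty m α).csSup_mem hf, fun _ hx => le_csSup hf.bddAbove hx⟩

end ForbConfig

/-! Put `q = r - 2`. A column is given by the set `S` of rows where it has a `0` or a `1`, the set
`A ⊆ S` of rows where it has a `1`, and one of `q` values in each other row. Two columns form `M` on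
rows `x, y, z` when one has `1` at `x` and `0` at `y, z` and the other has the complementary
pattern. So avoiding `M` means banning one of these two patterns for each `x` and `{y, z}`. A
relation `D` records which one, and all columns whose `A` is admissible on `S` may then be used
together. Hence `forb` is the maximum over `D` of `∑ S, |admissibleSets D S| * q ^ (m - |S|)`.

On each triple `D` singles out one element: the one where its value differs from the two others,
with ties broken by a rank. The triple chooses the edge opposite to it, which gives a TCM. Let `N e`
consist of the `w` whose triple with `e` chooses `e`, so `|N e|` is the multiplicity of `e`. The
core is `card_admissibleSets_le`: there are at most `|S| + 1 + f` admissible sets, with `f` the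
number of edges of `S` chosen by every triple of `S` containing them. Indeed admissible sets of
different sizes are nested and those of equal size form a star or a costar, so the family is a chain
with some widened levels. A level that would break the bound `|S| + 1` pays with such an edge. For
2-recursive multigraphs, gluing (`card_admissibleSets_union`) provides a `D` that reaches this
number on every `S`.

Summing over `S` with weight `q ^ (m - |S|)`, the part `|S| + 1` gives the two explicit terms, and
an edge of multiplicity `k` gives `q ^ (m - 2 - k) * (q + 1) ^ k`, its term of the weight times `q ^
(m - 2)`. -/

namespace ForbConfig

/-! ### Admissible sets and the structure of their levels. -/

section Admissible

variable {W : Type*}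

/-- `A ⊆ S` is admissible for `D` if its trace on each triple `{x, y, z}` of `S` is neither `{x}`
when `D x y z` holds nor `{y, z}` when `D x y z` fails. -/
def Admissible (D : W → W → W → Prop) (S A : Finset W) : Prop :=
  A ⊆ S ∧ ∀ x ∈ S, ∀ y ∈ S, ∀ z ∈ S, x ≠ y → x ≠ z → y ≠ z →
    (x ∈ A → y ∉ A → z ∉ A → ¬ D x y z) ∧ (x ∉ A → y ∈ A → z ∈ A → D x y z)

open Classical in
/-- The family of the admissible subsets of `S`. -/
noncomputable def admissibleSets (D : W → W → W → Prop) (S : Finset W) : Finset (Finset W) :=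
  S.powerset.filter (Admissible D S)

theorem mem_admissibleSets {D : W → W → W → Prop} {S A : Finset W} :
    A ∈ admissibleSets D S ↔ Admissible D S A := by
  simp only [admissibleSets, Finset.mem_filter, Finset.mem_powerset, and_iff_right_iff_imp]
  exact fun h => h.1

theorem Admissible.empty (D : W → W → W → Prop) (S : Finset W) : Admissible D S ∅ :=
  ⟨Finset.empty_subset _, by simp⟩

theorem Admissible.self (D : W → W → W → Prop) (S : Finset W) : Admissible D S S :=
  ⟨subset_rfl, by grind⟩

/-- A set which is both a union and an intersection of admissible sets is admissible. -/
theorem Admissible.of_union_of_inter {D : W → W → W → Prop} {S X : Finset W} (hX : X ⊆ S)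
    (hU : ∀ x ∈ X, ∃ B, Admissible D S B ∧ B ⊆ X ∧ x ∈ B)
    (hI : ∀ x ∈ S, x ∉ X → ∃ B, Admissible D S B ∧ X ⊆ B ∧ x ∉ B) : Admissible D S X := by
  refine ⟨hX, fun x hx y hy z hz hxy hxz hyz => ⟨fun h₁ h₂ h₃ => ?_, fun h₁ h₂ h₃ => ?_⟩⟩
  · obtain ⟨B, hB, hBX, hxB⟩ := hU x h₁
    exact (hB.2 x hx y hy z hz hxy hxz hyz).1 hxB (fun h => h₂ (hBX h)) (fun h => h₃ (hBX h))
  · obtain ⟨B, hB, hBX, hxB⟩ := hI x hx h₁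
    exact (hB.2 x hx y hy z hz hxy hxz hyz).2 hxB (hBX h₂) (hBX h₃)

variable [DecidableEq W]

/-- The edges `e` inside `S` for which all other elements of `S` lie in `N e`. -/
def fullEdges (N : Sym2 W → Finset W) (S : Finset W) : Finset (Sym2 W) :=
  (edgesOn S).filter fun e => ∀ w ∈ S, w ∉ e → w ∈ N e

/-- With `x ∈ B \ A` and distinct `y, z ∈ A \ B`, the traces of `B` and `A` on `{x, y, z}` would be
`{x}` and `{y, z}`, and one of these is banned. -/
theorem Admissible.card_sdiff_le_one {D : W → W → W → Prop} {S A B : Finset W}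
    (hA : Admissible D S A) (hB : Admissible D S B) (h : ¬ B ⊆ A) : (A \ B).card ≤ 1 := by
  by_contra hc
  obtain ⟨y, hy, z, hz, hyz⟩ := Finset.one_lt_card.1 (not_le.1 hc)
  obtain ⟨x, hxB, hxA⟩ := Finset.not_subset.1 h
  rw [Finset.mem_sdiff] at hy hz
  have hxy : x ≠ y := fun h => hxA (h ▸ hy.1)
  have hxz : x ≠ z := fun h => hxA (h ▸ hz.1)
  exact (hB.2 x (hB.1 hxB) y (hA.1 hy.1) z (hA.1 hz.1) hxy hxz hyz).1 hxB hy.2 hz.2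
    ((hA.2 x (hB.1 hxB) y (hA.1 hy.1) z (hA.1 hz.1) hxy hxz hyz).2 hxA hy.1 hz.1)

theorem Admissible.subset_of_card_lt {D : W → W → W → Prop} {S A B : Finset W}
    (hA : Admissible D S A) (hB : Admissible D S B) (h : A.card < B.card) : A ⊆ B := by
  by_contra hn
  have h₁ := hB.card_sdiff_le_one hA hn
  have h₂ : 0 < (A \ B).card := Finset.card_pos.2 (Finset.sdiff_nonempty.2 hn)
  have h₃ := Finset.card_sdiff_add_card_inter A B
  have h₄ := Finset.card_sdiff_add_card_inter B A
  rw [Finset.inter_comm] at h₄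
  omega

/-- A uniform family of at least two sets which pairwise differ by an exchange is a star or a
costar. -/
theorem exists_star_or_costar {L : Finset (Finset W)} (hL : 1 < L.card) {k : ℕ}
    (hk : ∀ A ∈ L, A.card = k) (hd : ∀ A ∈ L, ∀ B ∈ L, (A \ B).card ≤ 1) :
    ∃ C E : Finset W, Disjoint C E ∧ 1 < E.card ∧ L.card = E.card ∧
      ((∀ A, A ∈ L ↔ ∃ e ∈ E, A = insert e C) ∨ (∀ A, A ∈ L ↔ ∃ e ∈ E, A = (C ∪ E).erase e)) := by
  classical
  obtain ⟨A, hA, B, hB, hAB⟩ := Finset.one_lt_card.1 hL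
  have key : ∀ P ∈ L, ∀ Q ∈ L, P ≠ Q → ∃ p q, p ∈ P ∧ p ∉ Q ∧ q ∈ Q ∧ q ∉ P ∧
      (∀ x ∈ P, x ≠ p → x ∈ Q) ∧ (∀ x ∈ Q, x ≠ q → x ∈ P) := by
    have aux : ∀ P ∈ L, ∀ Q ∈ L, P ≠ Q → ∃ p, p ∈ P ∧ p ∉ Q ∧ ∀ x ∈ P, x ≠ p → x ∈ Q := by
      intro P hP Q hQ hPQ
      have hn : ¬ P ⊆ Q := fun h =>
        hPQ (Finset.eq_of_subset_of_card_le h (by rw [hk P hP, hk Q hQ]))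
      obtain ⟨p, hp, hpQ⟩ := Finset.not_subset.1 hn
      refine ⟨p, hp, hpQ, fun x hx hxp => ?_⟩
      by_contra hxQ
      exact hxp (Finset.card_le_one.1 (hd P hP Q hQ) x (by simp [hx, hxQ]) p (by simp [hp, hpQ]))
    intro P hP Q hQ hPQ
    obtain ⟨p, h₁, h₂, h₃⟩ := aux P hP Q hQ hPQ
    obtain ⟨q, h₄, h₅, h₆⟩ := aux Q hQ P hP hPQ.symm
    exact ⟨p, q, h₁, h₂, h₄, h₅, h₃, h₆⟩
  obtain ⟨a, b, ha, haB, hb, hbA, hA', hB'⟩ := key A hA B hB hAB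
  -- If every member contains `A ∩ B`, each adds one element to it: a star. Otherwise some `P`
  -- misses an `x ∈ A ∩ B`, and all members turn out to be `A ∪ B` minus one element: a costar.
  by_cases hstar : ∀ P ∈ L, A ∩ B ⊆ P
  · have hex : ∀ P ∈ L, ∃ e, e ∉ A ∩ B ∧ P = insert e (A ∩ B) := by
      intro P hP
      have hAB' : A = insert a (A ∩ B) := by
        ext x
        by_cases hx : x = a
        · simp [hx, ha]
        · have := hA' x
          simp [hx]; tauto
      have hcard : (P \ (A ∩ B)).card = 1 := by
        have h₁ := Finset.card_sdiff_of_subset (hstar P hP)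
        have h₂ := hk P hP
        have h₃ := hk A hA
        rw [hAB', Finset.card_insert_of_notMem (by simp [haB])] at h₃
        omega
      obtain ⟨e, he⟩ := Finset.card_eq_one.1 hcard
      have he' := Finset.ext_iff.1 he
      refine ⟨e, (Finset.mem_sdiff.1 ((he' e).2 (by simp))).2, ?_⟩
      rw [← Finset.sdiff_union_of_subset (hstar P hP), he]
      rfl
    set E := (L.sup id) \ (A ∩ B) with hE
    have hmem : ∀ P, P ∈ L ↔ ∃ e ∈ E, P = insert e (A ∩ B) := by
      intro P
      constructor
      · intro hP
        obtain ⟨e, he, rfl⟩ := hex P hP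
        refine ⟨e, ?_, rfl⟩
        rw [hE, Finset.mem_sdiff, Finset.mem_sup]
        exact ⟨⟨_, hP, by simp⟩, he⟩
      · rintro ⟨e, he, rfl⟩
        rw [hE, Finset.mem_sdiff, Finset.mem_sup] at he
        obtain ⟨⟨Q, hQ, heQ⟩, hn⟩ := he
        obtain ⟨e', he', rfl⟩ := hex Q hQ
        simp only [id, Finset.mem_insert] at heQ
        rcases heQ with rfl | heQ
        · exact hQ
        · exact absurd heQ hn
    have hcard : L.card = E.card := by
      have : L = E.image fun e => insert e (A ∩ B) := by
        ext P
        rw [hmem, Finset.mem_image]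
        simp only [eq_comm]
      rw [this, Finset.card_image_of_injOn]
      intro e he e' he' h
      have hn : e ∉ A ∩ B := (Finset.mem_sdiff.1 he).2
      have h' : insert e (A ∩ B) = insert e' (A ∩ B) := h
      have : e ∈ insert e' (A ∩ B) := h' ▸ Finset.mem_insert_self _ _
      rcases Finset.mem_insert.1 this with h | h
      · exact h
      · exact absurd h hn
    exact ⟨A ∩ B, E, Finset.disjoint_sdiff, hcard ▸ hL, hcard, .inl hmem⟩
  · push Not at hstar
    obtain ⟨P, hP, hPn⟩ := hstar
    obtain ⟨x, hx, hxP⟩ := Finset.not_subset.1 hPn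
    rw [Finset.mem_inter] at hx
    -- If `Q` had an element `y` outside `A ∪ B`, then `Q` would miss `a` and hence contain `x`,
    -- while `P` contains `b` and hence misses `y`. Then `Q \ P` would contain both `x` and `y`.
    have hsub : ∀ Q ∈ L, Q ⊆ A ∪ B := by
      intro Q hQ
      by_contra hn
      obtain ⟨y, hy, hyn⟩ := Finset.not_subset.1 hn
      rw [Finset.mem_union, not_or] at hyn
      have huniq : ∀ P ∈ L, ∀ Q ∈ L, ∀ u ∈ P, u ∉ Q → ∀ v ∈ P, v ∉ Q → u = v :=
        fun P hP Q hQ u hu hu' v hv hv' => Finset.card_le_one.1 (hd P hP Q hQ) u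
          (Finset.mem_sdiff.2 ⟨hu, hu'⟩) v (Finset.mem_sdiff.2 ⟨hv, hv'⟩)
      have haQ : a ∉ Q := fun h => hyn.1 (huniq Q hQ B hB a h haB y hy hyn.2 ▸ ha)
      have hxQ : x ∈ Q := by
        by_contra hxQ
        exact haB (huniq A hA Q hQ x hx.1 hxQ a ha haQ ▸ hx.2)
      have hbP : b ∈ P := by
        by_contra hbP
        exact hbA (huniq B hB P hP x hx.2 hxP b hb hbP ▸ hx.1)
      have hyP : y ∉ P := fun hyP => hyn.2 (huniq P hP A hA b hbP hbA y hyP hyn.1 ▸ hb)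
      exact hyn.1 (huniq Q hQ P hP x hxQ hxP y hy hyP ▸ hx.1)
    set U := A ∪ B with hU
    have hUcard : U.card = k + 1 := by
      have : U = insert b A := by
        ext x
        by_cases hx : x = b
        · simp [hx, hU, hb]
        · have := hB' x
          simp [hx, hU]; tauto
      rw [this, Finset.card_insert_of_notMem hbA, hk A hA]
    have hex : ∀ Q ∈ L, ∃ e, e ∈ U ∧ e ∉ Q ∧ Q = U.erase e := by
      intro Q hQ
      have hcard : (U \ Q).card = 1 := by
        rw [Finset.card_sdiff_of_subset (hsub Q hQ), hUcard, hk Q hQ]; omega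
      obtain ⟨e, he⟩ := Finset.card_eq_one.1 hcard
      have h := Finset.mem_sdiff.1 ((Finset.ext_iff.1 he e).2 (by simp))
      refine ⟨e, h.1, h.2, ?_⟩
      rw [← Finset.sdiff_singleton_eq_erase, ← he, Finset.sdiff_sdiff_eq_self (hsub Q hQ)]
    set E := U.filter fun e => U.erase e ∈ L with hE
    have hEU : E ⊆ U := Finset.filter_subset _ _
    have hmem : ∀ P, P ∈ L ↔ ∃ e ∈ E, P = (U \ E ∪ E).erase e := by
      intro P
      rw [Finset.sdiff_union_of_subset hEU]
      constructor
      · intro hP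
        obtain ⟨e, he, -, rfl⟩ := hex P hP
        exact ⟨e, Finset.mem_filter.2 ⟨he, hP⟩, rfl⟩
      · rintro ⟨e, he, rfl⟩
        exact (Finset.mem_filter.1 he).2
    have hcard : L.card = E.card := by
      have : L = E.image fun e => U.erase e := by
        ext P
        rw [hmem, Finset.mem_image, Finset.sdiff_union_of_subset hEU]
        simp only [eq_comm]
      rw [this, Finset.card_image_of_injOn]
      intro e he e' he' h
      by_contra hne
      have : e ∈ U.erase e := by
        rw [show U.erase e = U.erase e' from h]
        exact Finset.mem_erase.2 ⟨hne, hEU he⟩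
      simp at this
    exact ⟨U \ E, E, Finset.sdiff_disjoint, hcard ▸ hL, hcard, .inr hmem⟩

end Admissible

/-! ### At most `|S| + 1` admissible sets plus one per full edge. -/

section UpperBound

variable {W : Type*}

/-- Among `a`, `b`, `w`, the element `w` is the one at which `D` differs from its common value at
the two others, or the one of largest rank if `D` is constant. -/
def Distinguished (D : W → W → W → Prop) (ρ : W → ℕ) (a b w : W) : Prop :=
  (D w a b ∧ ¬ D a b w ∧ ¬ D b a w) ∨ (¬ D w a b ∧ D a b w ∧ D b a w) ∨
    ((D w a b ↔ D a b w) ∧ (D w a b ↔ D b a w) ∧ ρ a < ρ w ∧ ρ b < ρ w)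

variable [DecidableEq W] {D : W → W → W → Prop} {ρ : W → ℕ} {N : Sym2 W → Finset W}
  {S : Finset W}

/-- A star or costar of admissible sets whose core and hull are admissible contains a full
edge. -/
theorem exists_mem_fullEdges (hρ : Function.Injective ρ)
    (hN : ∀ a ∈ S, ∀ b ∈ S, ∀ w ∈ S, a ≠ b → a ≠ w → b ≠ w → Distinguished D ρ a b w →
      w ∈ N s(a, b))
    {C E : Finset W} (hd : Disjoint C E) (hE : 1 < E.card) (hC : Admissible D S C)
    (hU : Admissible D S (C ∪ E))
    (hL : (∀ e ∈ E, Admissible D S (insert e C)) ∨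
      (∀ e ∈ E, Admissible D S ((C ∪ E).erase e))) :
    ∃ a ∈ E, ∃ b ∈ E, s(a, b) ∈ fullEdges N S := by
  have hEC : ∀ x ∈ E, x ∉ C := fun x hx hxC => Finset.disjoint_left.1 hd hxC hx
  -- The full edge joins the two elements of least rank in `E`, so any third element of `E` wins the
  -- tie-break.
  obtain ⟨a, haE, ha⟩ := Finset.exists_min_image E ρ (Finset.card_pos.1 (by omega))
  obtain ⟨b, hbE, hb⟩ := Finset.exists_min_image (E.erase a) ρ
    (Finset.card_pos.1 (by rw [Finset.card_erase_of_mem haE]; omega))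
  obtain ⟨hba, hbE⟩ := Finset.mem_erase.1 hbE
  have hsep : ∀ e ∈ E, ∀ e' ∈ E, e ≠ e' →
      ∃ B, Admissible D S B ∧ C ⊆ B ∧ B ⊆ C ∪ E ∧ e ∈ B ∧ e' ∉ B := by
    intro e he e' he' hne
    rcases hL with hL | hL
    · refine ⟨_, hL e he, Finset.subset_insert _ _, ?_, by simp, ?_⟩
      · exact Finset.insert_subset (by simp [he]) Finset.subset_union_left
      · have := hEC e' he'
        grind
    · refine ⟨_, hL e' he', ?_, Finset.erase_subset _ _, by simp [hne, he], by simp⟩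
      have := hEC e' he'
      grind
  have hES : ∀ x ∈ E, x ∈ S := fun x hx => hU.1 (by simp [hx])
  refine ⟨a, haE, b, hbE, ?_⟩
  rw [fullEdges, Finset.mem_filter]
  refine ⟨mk_mem_edgesOn.2 ⟨hES a haE, hES b hbE, hba.symm⟩, fun w hw hwe => ?_⟩
  rw [Sym2.mem_iff, not_or] at hwe
  obtain ⟨hwa, hwb⟩ := hwe
  refine hN a (hES a haE) b (hES b hbE) w hw hba.symm (Ne.symm hwa) (Ne.symm hwb) ?_
  obtain ⟨B, hB, hCB, hBU, haB, hbB⟩ := hsep a haE b hbE hba.symm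
  obtain ⟨B', hB', hCB', hBU', hbB', haB'⟩ := hsep b hbE a haE hba
  have haS := hES a haE
  have hbS := hES b hbE
  -- The position of `w` fixes `D` on `{a, b, w}`. In the core, `D` fails at `w` only; outside the
  -- hull, it holds at `w` only; inside `E`, it is constant (false for a star, true for a costar)
  -- and the rank decides.
  by_cases hwC : w ∈ C
  · refine .inr (.inl ⟨?_, ?_, ?_⟩)
    · exact (hC.2 w hw a haS b hbS hwa hwb hba.symm).1 hwC (hEC a haE) (hEC b hbE)
    · exact (hB'.2 a haS b hbS w hw hba.symm (Ne.symm hwa) (Ne.symm hwb)).2 haB' hbB' (hCB' hwC)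
    · exact (hB.2 b hbS a haS w hw hba (Ne.symm hwb) (Ne.symm hwa)).2 hbB haB (hCB hwC)
  · by_cases hwE : w ∈ E
    · refine .inr (.inr ?_)
      have h₁ : ρ a < ρ w := lt_of_le_of_ne (ha w hwE) fun h => hwa (hρ h).symm
      have h₂ : ρ b < ρ w :=
        lt_of_le_of_ne (hb w (Finset.mem_erase.2 ⟨hwa, hwE⟩)) fun h => hwb (hρ h).symm
      rcases hL with hL | hL
      · have key : ∀ x ∈ E, ∀ y ∈ E, ∀ z ∈ E, x ≠ y → x ≠ z → y ≠ z → ¬ D x y z := by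
          intro x hx y hy z hz hxy hxz hyz
          have h₃ := hEC y hy
          have h₄ := hEC z hz
          exact ((hL x hx).2 x (hES x hx) y (hES y hy) z (hES z hz) hxy hxz hyz).1 (by simp)
            (by grind) (by grind)
        have k₁ := key w hwE a haE b hbE hwa hwb hba.symm
        have k₂ := key a haE b hbE w hwE hba.symm (Ne.symm hwa) (Ne.symm hwb)
        have k₃ := key b hbE a haE w hwE hba (Ne.symm hwb) (Ne.symm hwa)
        exact ⟨by tauto, by tauto, h₁, h₂⟩
      · have key : ∀ x ∈ E, ∀ y ∈ E, ∀ z ∈ E, x ≠ y → x ≠ z → y ≠ z → D x y z := by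
          intro x hx y hy z hz hxy hxz hyz
          exact ((hL x hx).2 x (hES x hx) y (hES y hy) z (hES z hz) hxy hxz hyz).2 (by simp)
            (by simp [hxy.symm, hy]) (by simp [hxz.symm, hz])
        have k₁ := key w hwE a haE b hbE hwa hwb hba.symm
        have k₂ := key a haE b hbE w hwE hba.symm (Ne.symm hwa) (Ne.symm hwb)
        have k₃ := key b hbE a haE w hwE hba (Ne.symm hwb) (Ne.symm hwa)
        exact ⟨by tauto, by tauto, h₁, h₂⟩
    · have hwU : w ∉ C ∪ E := by simp [hwC, hwE]
      refine .inl ⟨?_, ?_, ?_⟩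
      · exact (hU.2 w hw a haS b hbS hwa hwb hba.symm).2 hwU (by simp [haE]) (by simp [hbE])
      · exact (hB.2 a haS b hbS w hw hba.symm (Ne.symm hwa) (Ne.symm hwb)).1 haB hbB
          fun h => hwU (hBU h)
      · exact (hB'.2 b hbS a haS w hw hba (Ne.symm hwb) (Ne.symm hwa)).1 hbB' haB'
          fun h => hwU (hBU' h)

open Classical in
/-- The bound for the admissible sets below a set `X` which is comparable to all admissible sets
and is an intersection of admissible sets. -/
theorem card_filter_admissibleSets_le (hρ : Function.Injective ρ)
    (hN : ∀ a ∈ S, ∀ b ∈ S, ∀ w ∈ S, a ≠ b → a ≠ w → b ≠ w → Distinguished D ρ a b w →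
      w ∈ N s(a, b)) (n : ℕ) :
    ∀ X ⊆ S, X.card = n → (∀ A, Admissible D S A → A ⊆ X ∨ X ⊆ A) →
      (∀ x ∈ S, x ∉ X → ∃ B, Admissible D S B ∧ X ⊆ B ∧ x ∉ B) →
      ((admissibleSets D S).filter (· ⊆ X)).card ≤
        X.card + (if Admissible D S X then 1 else 0) +
          ((fullEdges N S).filter fun e => ∀ v ∈ e, v ∈ X).card := by
  -- The induction descends from one set comparable to all admissible sets to the next. The core of
  -- a star or costar need not be admissible, hence the indicator in the bound.
  induction n using Nat.strong_induction_on with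
  | _ n ih =>
  intro X hXS hXn hcut hinter
  by_cases hX0 : X = ∅
  · subst hX0
    have : (admissibleSets D S).filter (· ⊆ ∅) ⊆ {∅} := by
      intro A hA
      simpa using (Finset.mem_filter.1 hA).2
    have h := Finset.card_le_card this
    rw [if_pos (Admissible.empty D S)]
    simp at h ⊢
    omega
  -- the largest members strictly below `X`
  set F := (admissibleSets D S).filter (· ⊂ X) with hF
  have hmemF : ∀ A, A ∈ F ↔ Admissible D S A ∧ A ⊂ X := fun A => by
    rw [hF, Finset.mem_filter, mem_admissibleSets]
  have hF0 : (∅ : Finset W) ∈ F := (hmemF _).2 ⟨.empty D S,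
    Finset.empty_ssubset.2 (Finset.nonempty_iff_ne_empty.2 hX0)⟩
  obtain ⟨T, hTF, hT⟩ := Finset.exists_max_image F Finset.card ⟨_, hF0⟩
  set L := F.filter fun A => A.card = T.card with hL
  have hmemL : ∀ A, A ∈ L ↔ (Admissible D S A ∧ A ⊂ X) ∧ A.card = T.card := fun A => by
    rw [hL, Finset.mem_filter, hmemF]
  have hTL : T ∈ L := Finset.mem_filter.2 ⟨hTF, rfl⟩
  have hcountX : ((admissibleSets D S).filter (· ⊆ X)).card =
      F.card + if Admissible D S X then 1 else 0 := by
    split_ifs with h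
    · rw [← Finset.card_insert_of_notMem (s := F) (a := X) (by simp [hmemF])]
      congr 1
      ext A
      simp only [Finset.mem_filter, mem_admissibleSets, Finset.mem_insert, hmemF,
        subset_iff_ssubset_or_eq]
      grind
    · rw [add_zero]
      congr 1
      ext A
      simp only [Finset.mem_filter, mem_admissibleSets, hmemF, subset_iff_ssubset_or_eq]
      grind
  have hgmono : ∀ C, C ⊆ X → ((fullEdges N S).filter fun e => ∀ v ∈ e, v ∈ C).card ≤
      ((fullEdges N S).filter fun e => ∀ v ∈ e, v ∈ X).card := fun C hC =>
    Finset.card_le_card (Finset.monotone_filter_right _ fun e _ h v hv => hC (h v hv))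
  -- If the largest size below `X` is attained only by `T`, then `T` is the next set of the descent;
  -- it is admissible, and `|T| < |X|` pays for it.
  by_cases hL1 : L.card ≤ 1
  · have hLT : ∀ A ∈ L, A = T := fun A hA => Finset.card_le_one.1 hL1 A hA T hTL
    obtain ⟨hTa, hTX⟩ := (hmemF T).1 hTF
    have hTcut : ∀ A, Admissible D S A → A ⊂ X → A ⊆ T := by
      intro A hA hAX
      rcases (hT A ((hmemF A).2 ⟨hA, hAX⟩)).lt_or_eq with h | h
      · exact hA.subset_of_card_lt hTa h
      · exact (hLT A ((hmemL A).2 ⟨⟨hA, hAX⟩, h⟩)).le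
    have hFT : F = (admissibleSets D S).filter (· ⊆ T) := by
      ext A
      rw [hmemF, Finset.mem_filter, mem_admissibleSets]
      exact ⟨fun h => ⟨h.1, hTcut A h.1 h.2⟩, fun h => ⟨h.1, h.2.trans_ssubset hTX⟩⟩
    have hTc := Finset.card_lt_card hTX
    have := ih T.card (by omega) T hTa.1 rfl (fun A hA => by
      by_cases hAX : A ⊂ X
      · exact .inl (hTcut A hA hAX)
      · rcases hcut A hA with h | h
        · exact .inr (hTX.subset.trans (subset_iff_ssubset_or_eq.1 h |>.resolve_left hAX).ge)
        · exact .inr (hTX.subset.trans h)) (fun x _ hx => ⟨T, hTa, subset_rfl, hx⟩)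
    rw [if_pos hTa, ← hFT] at this
    have := hgmono T hTX.subset
    omega
  -- Otherwise the level is a star or costar. A smaller admissible set lies in all its members,
  -- hence in their intersection `C`, where the descent continues.
  · obtain ⟨C, E, hCE, hE1, hLE, hshape⟩ := exists_star_or_costar (L := L) (not_le.1 hL1)
      (k := T.card) (fun A hA => ((hmemL A).1 hA).2) (by
        intro A hA B hB
        obtain ⟨⟨hA₁, -⟩, hA₂⟩ := (hmemL A).1 hA
        obtain ⟨⟨hB₁, -⟩, hB₂⟩ := (hmemL B).1 hB
        by_cases h : B ⊆ A
        · rw [Finset.eq_of_subset_of_card_le h (by omega)]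
          simp
        · exact hA₁.card_sdiff_le_one hB₁ h)
    have hEC : ∀ x ∈ E, x ∉ C := fun x hx hxC => Finset.disjoint_left.1 hCE hxC hx
    obtain ⟨e₁, he₁, e₂, he₂, hne⟩ := Finset.one_lt_card.1 hE1
    have hsandwich : ∀ A ∈ L, C ⊆ A ∧ A ⊆ C ∪ E := by
      intro A hA
      rcases hshape with h | h
      · obtain ⟨e, he, rfl⟩ := (h A).1 hA
        exact ⟨Finset.subset_insert _ _, by grind⟩
      · obtain ⟨e, he, rfl⟩ := (h A).1 hA
        have := hEC e he
        exact ⟨by grind, Finset.erase_subset _ _⟩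
    have hsep : ∀ x ∈ C ∪ E, x ∉ C → (∃ A ∈ L, x ∈ A) ∧ ∃ A ∈ L, x ∉ A := by
      intro x hx hxC
      have hxE : x ∈ E := by simpa [hxC] using hx
      obtain ⟨y, hy, hxy⟩ : ∃ y ∈ E, x ≠ y := by
        by_cases h : x = e₁
        · exact ⟨e₂, he₂, h ▸ hne⟩
        · exact ⟨e₁, he₁, h⟩
      rcases hshape with h | h
      · exact ⟨⟨_, (h _).2 ⟨x, hxE, rfl⟩, by simp⟩, ⟨_, (h _).2 ⟨y, hy, rfl⟩, by simp [hxC, hxy]⟩⟩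
      · exact ⟨⟨_, (h _).2 ⟨y, hy, rfl⟩, by simp [hxE, hxy]⟩, ⟨_, (h _).2 ⟨x, hxE, rfl⟩, by simp⟩⟩
    have hUX : C ∪ E ⊆ X := by
      intro x hx
      by_cases hxC : x ∈ C
      · exact ((hmemL T).1 hTL).1.2.subset ((hsandwich T hTL).1 hxC)
      · obtain ⟨⟨A, hA, hxA⟩, -⟩ := hsep x hx hxC
        exact ((hmemL A).1 hA).1.2.subset hxA
    have hCX : C ⊆ X := Finset.subset_union_left.trans hUX
    have hUc : (C ∪ E).card = C.card + E.card := Finset.card_union_of_disjoint hCE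
    have hUXc := Finset.card_le_card hUX
    have hbelow : ∀ A, Admissible D S A → A ⊂ X → A ∉ L → A ⊆ C := by
      intro A hA hAX hAL
      have hlt : A.card < T.card := lt_of_le_of_ne (hT A ((hmemF A).2 ⟨hA, hAX⟩))
        fun h => hAL ((hmemL A).2 ⟨⟨hA, hAX⟩, h⟩)
      intro x hx
      by_contra hxC
      have hsub : ∀ B ∈ L, A ⊆ B := fun B hB => by
        obtain ⟨⟨hB₁, -⟩, hB₂⟩ := (hmemL B).1 hB
        exact hA.subset_of_card_lt hB₁ (by omega)
      obtain ⟨-, B, hB, hxB⟩ := hsep x ((hsandwich T hTL).2 (hsub T hTL hx)) hxC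
      exact hxB (hsub B hB hx)
    have hCcut : ∀ A, Admissible D S A → A ⊆ C ∨ C ⊆ A := by
      intro A hA
      by_cases hAX : A ⊂ X
      · by_cases hAL : A ∈ L
        · exact .inr (hsandwich A hAL).1
        · exact .inl (hbelow A hA hAX hAL)
      · rcases hcut A hA with h | h
        · exact .inr (hCX.trans (subset_iff_ssubset_or_eq.1 h |>.resolve_left hAX).ge)
        · exact .inr (hCX.trans h)
    have hCinter : ∀ x ∈ S, x ∉ C → ∃ B, Admissible D S B ∧ C ⊆ B ∧ x ∉ B := by
      intro x hx hxC
      by_cases hxU : x ∈ C ∪ E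
      · obtain ⟨-, B, hB, hxB⟩ := hsep x hxU hxC
        exact ⟨B, ((hmemL B).1 hB).1.1, (hsandwich B hB).1, hxB⟩
      · exact ⟨T, ((hmemF T).1 hTF).1, (hsandwich T hTL).1,
          fun h => hxU ((hsandwich T hTL).2 h)⟩
    have hih := ih C.card (by omega) C (hCX.trans hXS) rfl hCcut hCinter
    have hFle : F.card ≤ L.card + ((admissibleSets D S).filter (· ⊆ C)).card := by
      refine (Finset.card_le_card ?_).trans (Finset.card_union_le _ _)
      intro A hA
      obtain ⟨hA, hAX⟩ := (hmemF A).1 hA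
      by_cases hAL : A ∈ L
      · exact Finset.mem_union_left _ hAL
      · exact Finset.mem_union_right _
          (Finset.mem_filter.2 ⟨mem_admissibleSets.2 hA, hbelow A hA hAX hAL⟩)
    have hg := hgmono C hCX
    -- The level contributes `|E|` sets and `|C| + |E| ≤ |X|`, so only the unit for `C` itself can
    -- exceed the bound. It does so only if `C` is admissible and `C ∪ E = X`; then `X` is
    -- admissible too, and a full edge inside `E`, hence not inside `C`, absorbs the unit.
    by_cases hCa : Admissible D S C
    · rw [if_pos hCa] at hih
      by_cases hUX' : C ∪ E = X
      · have hXa : Admissible D S X := by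
          refine .of_union_of_inter hXS (fun x hx => ?_) hinter
          by_cases hxC : x ∈ C
          · exact ⟨C, hCa, hCX, hxC⟩
          · obtain ⟨⟨A, hA, hxA⟩, -⟩ := hsep x (hUX' ▸ hx) hxC
            exact ⟨A, ((hmemL A).1 hA).1.1, ((hmemL A).1 hA).1.2.subset, hxA⟩
        obtain ⟨a, ha, b, hb, hab⟩ := exists_mem_fullEdges hρ hN hCE hE1 hCa
          (hUX'.symm ▸ hXa) (hshape.imp
            (fun h e he => ((hmemL _).1 ((h _).2 ⟨e, he, rfl⟩)).1.1)
            (fun h e he => ((hmemL _).1 ((h _).2 ⟨e, he, rfl⟩)).1.1))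
        have hlt : ((fullEdges N S).filter fun e => ∀ v ∈ e, v ∈ C).card <
            ((fullEdges N S).filter fun e => ∀ v ∈ e, v ∈ X).card := by
          refine Finset.card_lt_card (Finset.ssubset_iff_of_subset
            (Finset.monotone_filter_right _ fun e _ h v hv => hCX (h v hv)) |>.2
            ⟨s(a, b), ?_, ?_⟩)
          · rw [Finset.mem_filter]
            refine ⟨hab, ?_⟩
            simp only [Sym2.mem_iff]
            rintro v (rfl | rfl)
            · exact hUX (by simp [ha])
            · exact hUX (by simp [hb])
          · rw [Finset.mem_filter]
            exact fun h => hEC a ha (h.2 a (Sym2.mem_mk_left a b))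
        omega
      · have := Finset.card_lt_card (hUX.ssubset_of_ne hUX')
        omega
    · rw [if_neg hCa] at hih
      omega

theorem card_admissibleSets_le (hρ : Function.Injective ρ)
    (hN : ∀ a ∈ S, ∀ b ∈ S, ∀ w ∈ S, a ≠ b → a ≠ w → b ≠ w → Distinguished D ρ a b w →
      w ∈ N s(a, b)) :
    (admissibleSets D S).card ≤ S.card + 1 + (fullEdges N S).card := by
  classical
  have h := card_filter_admissibleSets_le hρ hN S.card S subset_rfl rfl (fun A hA => .inl hA.1)
    (fun x hx hx' => absurd hx hx')
  rw [if_pos (Admissible.self D S), Finset.filter_true_of_mem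
    fun A hA => (mem_admissibleSets.1 hA).1] at h
  exact h.trans (Nat.add_le_add_left (Finset.card_filter_le _ _) _)

end UpperBound

/-! ### Gluing admissible families along a 2-recursive decomposition. -/

section LowerBound

variable {W : Type*} [DecidableEq W]

theorem card_edgesOn_of_card_le_two {S : Finset W} (hS : S.card ≤ 2) :
    S.card + 1 + (edgesOn S).card ≤ 2 ^ S.card := by
  rcases Nat.lt_or_ge S.card 2 with h | h
  · have : edgesOn S = ∅ := by
      refine Finset.eq_empty_of_forall_notMem fun e => ?_
      induction e with | _ a b =>
      rw [mk_mem_edgesOn]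
      rintro ⟨ha, hb, hab⟩
      exact hab (Finset.card_le_one.1 (by omega) a ha b hb)
    rw [this]
    interval_cases S.card <;> simp
  · obtain ⟨a, b, hab, rfl⟩ := Finset.card_eq_two.1 (le_antisymm hS h)
    have : edgesOn {a, b} ⊆ {s(a, b)} := by
      intro e
      induction e with | _ x y =>
      rw [mk_mem_edgesOn, Finset.mem_singleton, Sym2.eq_iff]
      grind
    have h₁ := Finset.card_le_card this
    rw [Finset.card_singleton] at h₁
    rw [Finset.card_pair hab]
    omega

theorem le_card_admissibleSets_of_card_le_two (D : W → W → W → Prop) (N : Sym2 W → Finset W)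
    {S : Finset W} (hS : S.card ≤ 2) :
    S.card + 1 + (fullEdges N S).card ≤ (admissibleSets D S).card := by
  have h : admissibleSets D S = S.powerset := by
    ext A
    rw [mem_admissibleSets, Finset.mem_powerset]
    refine ⟨fun h => h.1, fun h => ⟨h, fun x hx y hy z hz hxy hxz hyz => absurd hS ?_⟩⟩
    rw [not_le, Finset.two_lt_card]
    exact ⟨x, hx, y, hy, z, hz, hxy, hxz, hyz⟩
  rw [h, Finset.card_powerset]
  exact (Nat.add_le_add_left (Finset.card_le_card (Finset.filter_subset _ _)) _).trans
    (card_edgesOn_of_card_le_two hS)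

theorem IsTwoRecursive.mem_edgesOn {V : Finset W} {G : Multiset (Sym2 W)}
    (h : IsTwoRecursive V G) : ∀ e ∈ G, e ∈ edgesOn V := by
  induction h with
  | small V hV => simp
  | split V₁ V₂ G₁ G₂ hd h₁ h₂ hcard hG₁ hG₂ ih₁ ih₂ =>
    have hm : ∀ U : Finset W, U ⊆ V₁ ∪ V₂ → ∀ e ∈ edgesOn U, e ∈ edgesOn (V₁ ∪ V₂) := by
      intro U hU e
      induction e with | _ a b =>
      rw [mk_mem_edgesOn, mk_mem_edgesOn]
      exact fun h => ⟨hU h.1, hU h.2.1, h.2.2⟩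
    intro e he
    simp only [crossing, Multiset.mem_add, Multiset.mem_map, Finset.mem_val,
      Finset.mem_product] at he
    rcases he with (he | he) | ⟨p, hp, rfl⟩ | ⟨p, hp, rfl⟩
    · exact hm _ Finset.subset_union_left e (ih₁ e he)
    · exact hm _ Finset.subset_union_right e (ih₂ e he)
    · exact hm _ Finset.subset_union_left _ hp.1
    · exact hm _ Finset.subset_union_right _ hp.2

theorem count_map_fst_product {α β : Type*} [DecidableEq α] (s : Finset α) (t : Finset β) (a : α) :
    ((s ×ˢ t).val.map Prod.fst).count a = if a ∈ s then t.card else 0 := by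
  classical
  rw [Multiset.count_map]
  change (((s ×ˢ t).filter fun p => a = p.1)).card = _
  have : (s ×ˢ t).filter (fun p => a = p.1) = (s.filter fun x => a = x) ×ˢ t := by
    ext ⟨x, y⟩
    simp
    tauto
  rw [this, Finset.card_product, Finset.filter_eq]
  split_ifs <;> simp

theorem count_map_snd_product {α β : Type*} [DecidableEq β] (s : Finset α) (t : Finset β) (b : β) :
    ((s ×ˢ t).val.map Prod.snd).count b = if b ∈ t then s.card else 0 := by
  classical
  rw [Multiset.count_map]
  change (((s ×ˢ t).filter fun p => b = p.2)).card = _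
  have : (s ×ˢ t).filter (fun p => b = p.2) = s ×ˢ (t.filter fun x => b = x) := by
    ext ⟨x, y⟩
    simp
    tauto
  rw [this, Finset.card_product, Finset.filter_eq]
  split_ifs <;> simp

theorem count_crossing (V₁ V₂ : Finset W) (e : Sym2 W) :
    (crossing V₁ V₂).count e =
      (if e ∈ edgesOn V₁ then V₂.card else 0) + if e ∈ edgesOn V₂ then V₁.card else 0 := by
  rw [crossing, Multiset.count_add, count_map_fst_product, count_map_snd_product]

/-- The gluing of two families of admissible sets. -/
theorem card_admissibleSets_union {D₁ D₂ D : W → W → W → Prop} {S₁ S₂ : Finset W}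
    (hd : Disjoint S₁ S₂)
    (h₁ : ∀ x ∈ S₁, ∀ y ∈ S₁, ∀ z ∈ S₁, D x y z ↔ D₁ x y z)
    (h₂ : ∀ x ∈ S₂, ∀ y ∈ S₂, ∀ z ∈ S₂, D x y z ↔ D₂ x y z)
    (h₃ : ∀ x ∈ S₁, ∀ y ∈ S₁ ∪ S₂, ∀ z ∈ S₁ ∪ S₂, y ∉ S₁ ∨ z ∉ S₁ → ¬ D x y z)
    (h₄ : ∀ x ∈ S₂, ∀ y ∈ S₁ ∪ S₂, ∀ z ∈ S₁ ∪ S₂, y ∉ S₂ ∨ z ∉ S₂ → D x y z) :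
    (admissibleSets D₁ S₁).card + (admissibleSets D₂ S₂).card ≤
      (admissibleSets D (S₁ ∪ S₂)).card + 1 := by
  classical
  have hdis : ∀ x ∈ S₁, x ∉ S₂ := fun x hx hx' => Finset.disjoint_left.1 hd hx hx'
  have hinj : Set.InjOn (S₁ ∪ ·) (admissibleSets D₂ S₂ : Set (Finset W)) := by
    intro A hA B hB hAB
    have hA' := (mem_admissibleSets.1 hA).1
    have hB' := (mem_admissibleSets.1 hB).1
    ext x
    have h := Finset.ext_iff.1 (show S₁ ∪ A = S₁ ∪ B from hAB) x
    rw [Finset.mem_union, Finset.mem_union] at h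
    have := hdis x
    have := @hA' x
    have := @hB' x
    tauto
  -- The admissible subsets of `S₁`, and the sets `S₁ ∪ A` with `A` admissible in `S₂`, are all
  -- admissible. The two families can share only `S₁`, which accounts for the `+ 1`.
  rw [← Finset.card_image_of_injOn hinj, ← Finset.card_union_add_card_inter]
  refine Nat.add_le_add (Finset.card_le_card fun A hA => ?_) (Finset.card_le_one.2 ?_)
  · rw [mem_admissibleSets]
    rw [Finset.mem_union, mem_admissibleSets, Finset.mem_image] at hA
    rcases hA with hA | ⟨A, hA, rfl⟩
    · refine ⟨hA.1.trans Finset.subset_union_left, fun x hx y hy z hz hxy hxz hyz => ⟨?_, ?_⟩⟩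
      · intro hxA hyA hzA
        have hx₁ := hA.1 hxA
        by_cases hyz₁ : y ∈ S₁ ∧ z ∈ S₁
        · rw [h₁ x hx₁ y hyz₁.1 z hyz₁.2]
          exact (hA.2 x hx₁ y hyz₁.1 z hyz₁.2 hxy hxz hyz).1 hxA hyA hzA
        · exact h₃ x hx₁ y hy z hz (not_and_or.1 hyz₁)
      · intro hxA hyA hzA
        have hy₁ := hA.1 hyA
        have hz₁ := hA.1 hzA
        rcases Finset.mem_union.1 hx with hx | hx
        · rw [h₁ x hx y hy₁ z hz₁]
          exact (hA.2 x hx y hy₁ z hz₁ hxy hxz hyz).2 hxA hyA hzA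
        · exact h₄ x hx y hy z hz (.inl (hdis y hy₁))
    · rw [mem_admissibleSets] at hA
      refine ⟨Finset.union_subset_union_right hA.1,
        fun x hx y hy z hz hxy hxz hyz => ⟨?_, ?_⟩⟩
      · intro hxA hyA hzA
        rw [Finset.mem_union, not_or] at hyA hzA
        have hy₂ := (Finset.mem_union.1 hy).resolve_left hyA.1
        have hz₂ := (Finset.mem_union.1 hz).resolve_left hzA.1
        rcases Finset.mem_union.1 hx with hx | hx
        · exact h₃ x hx y hy z hz (.inl hyA.1)
        · have hxA' : x ∈ A := (Finset.mem_union.1 hxA).resolve_left fun h => hdis x h hx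
          rw [h₂ x hx y hy₂ z hz₂]
          exact (hA.2 x hx y hy₂ z hz₂ hxy hxz hyz).1 hxA' hyA.2 hzA.2
      · intro hxA hyA hzA
        rw [Finset.mem_union, not_or] at hxA
        have hx₂ := (Finset.mem_union.1 hx).resolve_left hxA.1
        by_cases hyz₂ : y ∈ S₂ ∧ z ∈ S₂
        · rw [h₂ x hx₂ y hyz₂.1 z hyz₂.2]
          exact (hA.2 x hx₂ y hyz₂.1 z hyz₂.2 hxy hxz hyz).2 hxA.2
            ((Finset.mem_union.1 hyA).resolve_left fun h => hdis y h hyz₂.1)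
            ((Finset.mem_union.1 hzA).resolve_left fun h => hdis z h hyz₂.2)
        · exact h₄ x hx₂ y hy z hz (not_and_or.1 hyz₂)
  · have : ∀ A ∈ admissibleSets D₁ S₁ ∩ (admissibleSets D₂ S₂).image (S₁ ∪ ·), A = S₁ := by
      intro A hA
      rw [Finset.mem_inter, mem_admissibleSets, Finset.mem_image] at hA
      obtain ⟨hA, B, -, rfl⟩ := hA
      exact hA.1.antisymm Finset.subset_union_left
    intro A hA B hB
    rw [this A hA, this B hB]

/-- For a 2-recursive multigraph on `V`, some choice of admissible sets attains the upper bound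
on each subset of `V`. -/
theorem IsTwoRecursive.exists_admissibleSets {V : Finset W} {G : Multiset (Sym2 W)}
    (h : IsTwoRecursive V G) :
    ∃ (D : W → W → W → Prop) (N : Sym2 W → Finset W),
      (∀ e ∈ edgesOn V, N e ⊆ V ∧ (∀ w ∈ N e, w ∉ e) ∧ (N e).card = G.count e) ∧
      ∀ S ⊆ V, S.card + 1 + (fullEdges N S).card ≤ (admissibleSets D S).card := by
  classical
  induction h with
  | small V hV =>
    exact ⟨fun _ _ _ => True, fun _ => ∅, by simp, fun S hS =>
      le_card_admissibleSets_of_card_le_two _ _ ((Finset.card_le_card hS).trans hV)⟩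
  | split V₁ V₂ G₁ G₂ hd _ _ _ hG₁ hG₂ ih₁ ih₂ =>
    obtain ⟨D₁, N₁, hN₁, hS₁⟩ := ih₁
    obtain ⟨D₂, N₂, hN₂, hS₂⟩ := ih₂
    have hdis : ∀ x ∈ V₁, x ∉ V₂ := fun x hx hx' => Finset.disjoint_left.1 hd hx hx'
    have hedge : ∀ e ∈ edgesOn V₁, e ∉ edgesOn V₂ := by
      intro e
      induction e with | _ a b =>
      rw [mk_mem_edgesOn, mk_mem_edgesOn]
      exact fun h h' => hdis a h.1 h'.1
    -- On a triple meeting both parts, `D` holds exactly at the elements of `V₂`. The element alone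
    -- on its side is thus the odd one, and the triple chooses the pair on the other side, as in
    -- `crossing`.
    set D : W → W → W → Prop := fun x y z =>
      if x ∈ V₁ ∧ y ∈ V₁ ∧ z ∈ V₁ then D₁ x y z
      else if x ∈ V₂ ∧ y ∈ V₂ ∧ z ∈ V₂ then D₂ x y z else x ∈ V₂ with hD
    set N : Sym2 W → Finset W := fun e =>
      if e ∈ edgesOn V₁ then N₁ e ∪ V₂ else if e ∈ edgesOn V₂ then N₂ e ∪ V₁ else ∅ with hN
    refine ⟨D, N, fun e he => ?_, fun S hS => ?_⟩
    · rw [Multiset.count_add, Multiset.count_add, count_crossing]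
      by_cases he₁ : e ∈ edgesOn V₁
      · obtain ⟨hi, hii, hiii⟩ := hN₁ e he₁
        have he₂ := hedge e he₁
        have hc : G₂.count e = 0 := Multiset.count_eq_zero.2 fun h => he₂ (hG₂.mem_edgesOn e h)
        simp only [hN, if_pos he₁, if_neg he₂, hc]
        refine ⟨Finset.union_subset_union_left hi, fun w hw hwe => ?_, ?_⟩
        · rcases Finset.mem_union.1 hw with hw' | hw'
          · exact hii w hw' hwe
          · induction e with | _ a b =>
            rw [mk_mem_edgesOn] at he₁
            rcases Sym2.mem_iff.1 hwe with rfl | rfl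
            · exact hdis _ he₁.1 hw'
            · exact hdis _ he₁.2.1 hw'
        · rw [Finset.card_union_of_disjoint (hd.mono_left hi), hiii]
          omega
      · by_cases he₂ : e ∈ edgesOn V₂
        · obtain ⟨hi, hii, hiii⟩ := hN₂ e he₂
          have hc : G₁.count e = 0 := Multiset.count_eq_zero.2 fun h => he₁ (hG₁.mem_edgesOn e h)
          simp only [hN, if_pos he₂, if_neg he₁, hc]
          refine ⟨by rw [Finset.union_comm]; exact Finset.union_subset_union_right hi,
            fun w hw hwe => ?_, ?_⟩
          · rcases Finset.mem_union.1 hw with hw' | hw'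
            · exact hii w hw' hwe
            · induction e with | _ a b =>
              rw [mk_mem_edgesOn] at he₂
              rcases Sym2.mem_iff.1 hwe with rfl | rfl
              · exact hdis _ hw' he₂.1
              · exact hdis _ hw' he₂.2.1
          · rw [Finset.card_union_of_disjoint (hd.symm.mono_left hi), hiii]
            omega
        · have hc₁ : G₁.count e = 0 := Multiset.count_eq_zero.2 fun h => he₁ (hG₁.mem_edgesOn e h)
          have hc₂ : G₂.count e = 0 := Multiset.count_eq_zero.2 fun h => he₂ (hG₂.mem_edgesOn e h)
          simp [hN, he₁, he₂, hc₁, hc₂]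
    -- Sets with at most two elements are treated apart: there an edge between the parts is
    -- vacuously full.
    · rcases Nat.lt_or_ge 2 S.card with hS3 | hS2
      swap
      · exact le_card_admissibleSets_of_card_le_two D N hS2
      have hSu : S ∩ V₁ ∪ S ∩ V₂ = S := by
        rw [← Finset.inter_union_distrib_left, Finset.inter_eq_left.2 hS]
      have hSd : Disjoint (S ∩ V₁) (S ∩ V₂) :=
        hd.mono Finset.inter_subset_right Finset.inter_subset_right
      have hglue := card_admissibleSets_union (D₁ := D₁) (D₂ := D₂) (D := D) hSd
        (by
          intro x hx y hy z hz
          rw [Finset.mem_inter] at hx hy hz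
          simp [hD, hx.2, hy.2, hz.2])
        (by
          intro x hx y hy z hz
          rw [Finset.mem_inter] at hx hy hz
          have : x ∉ V₁ := fun h => hdis x h hx.2
          simp [hD, hx.2, hy.2, hz.2, this])
        (by
          intro x hx y hy z hz hyz
          rw [hSu] at hy hz
          rw [Finset.mem_inter] at hx
          simp only [Finset.mem_inter, hy, hz, true_and] at hyz
          have hx₂ : x ∉ V₂ := hdis x hx.2
          simp only [hD]
          rw [if_neg (by tauto), if_neg fun h => hx₂ h.1]
          exact hx₂)
        (by
          intro x hx y hy z hz hyz
          rw [hSu] at hy hz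
          rw [Finset.mem_inter] at hx
          simp only [Finset.mem_inter, hy, hz, true_and] at hyz
          have hx₁ : x ∉ V₁ := fun h => hdis x h hx.2
          simp only [hD]
          rw [if_neg fun h => hx₁ h.1, if_neg (by tauto)]
          exact hx.2)
      rw [hSu] at hglue
      have hcard : S.card = (S ∩ V₁).card + (S ∩ V₂).card := by
        rw [← Finset.card_union_of_disjoint hSd, hSu]
      -- An edge between the parts has `N e = ∅`, so a third element of `S` prevents it from being
      -- full.
      have hfull : fullEdges N S ⊆ fullEdges N₁ (S ∩ V₁) ∪ fullEdges N₂ (S ∩ V₂) := by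
        intro e he
        obtain ⟨he, hw⟩ := Finset.mem_filter.1 he
        rw [Finset.mem_union, fullEdges, fullEdges, Finset.mem_filter, Finset.mem_filter]
        by_cases he₁ : e ∈ edgesOn V₁
        · refine .inl ⟨?_, fun w hwS hwe => ?_⟩
          · induction e with | _ a b =>
            rw [mk_mem_edgesOn] at *
            simp_all
          · rw [Finset.mem_inter] at hwS
            have := hw w hwS.1 hwe
            simp only [hN, if_pos he₁, Finset.mem_union] at this
            exact this.resolve_right (hdis w hwS.2)
        · by_cases he₂ : e ∈ edgesOn V₂
          · refine .inr ⟨?_, fun w hwS hwe => ?_⟩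
            · induction e with | _ a b =>
              rw [mk_mem_edgesOn] at *
              simp_all
            · rw [Finset.mem_inter] at hwS
              have := hw w hwS.1 hwe
              simp only [hN, if_neg he₁, if_pos he₂, Finset.mem_union] at this
              exact this.resolve_right fun h => hdis w h hwS.2
          · simp only [hN, if_neg he₁, if_neg he₂, Finset.notMem_empty] at hw
            exfalso
            induction e with | _ a b =>
            obtain ⟨w, hwS, hwab⟩ := Finset.exists_mem_notMem_of_card_lt_card
              ((Finset.card_le_two (a := a) (b := b)).trans_lt hS3)
            exact hw w hwS (by simpa using hwab)
      have h₁ := hS₁ (S ∩ V₁) Finset.inter_subset_right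
      have h₂ := hS₂ (S ∩ V₂) Finset.inter_subset_right
      have h₃ := (Finset.card_le_card hfull).trans (Finset.card_union_le _ _)
      omega

end LowerBound

/-! ### Summation over the sets `S` and comparison with the weight. -/

section Counting

variable {W : Type*} [DecidableEq W]

/-- Elements of `E` are forced into `S` (factor `1`), those of `R` are free (factor `1 + q`), and
the others are excluded (factor `q`). -/
theorem sum_pow_between (q : ℕ) {V E R : Finset W} (hE : E ⊆ V) (hR : R ⊆ V) (hd : Disjoint E R) :
    ∑ S ∈ V.powerset with E ⊆ S ∧ S \ E ⊆ R, q ^ (V.card - S.card) =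
      q ^ (V.card - E.card - R.card) * (q + 1) ^ R.card := by
  have hle : E.card + R.card ≤ V.card := by
    rw [← Finset.card_union_of_disjoint hd]
    exact Finset.card_le_card (Finset.union_subset hE hR)
  rw [add_comm q 1, ← Finset.sum_pow_mul_eq_add_pow 1 q R, Finset.mul_sum]
  refine Finset.sum_nbij' (· \ E) (E ∪ ·) ?_ ?_ ?_ ?_ ?_
  · intro S hS
    simp only [Finset.mem_filter] at hS
    exact Finset.mem_powerset.2 hS.2.2
  · intro T hT
    have hT := Finset.mem_powerset.1 hT
    simp only [Finset.mem_filter, Finset.mem_powerset]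
    refine ⟨Finset.union_subset hE (hT.trans hR), Finset.subset_union_left, ?_⟩
    rw [Finset.union_sdiff_left]
    exact Finset.sdiff_subset.trans hT
  · intro S hS
    simp only [Finset.mem_filter] at hS
    exact Finset.union_sdiff_of_subset hS.2.1
  · intro T hT
    have hT := Finset.mem_powerset.1 hT
    rw [Finset.union_sdiff_left]
    exact Finset.sdiff_eq_self_of_disjoint (hd.symm.mono_left hT)
  · intro S hS
    simp only [Finset.mem_filter, Finset.mem_powerset] at hS
    obtain ⟨hSV, hES, hSR⟩ := hS
    have h₁ := Finset.card_le_card hSR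
    have h₂ := Finset.card_sdiff_of_subset hES
    have h₃ := Finset.card_le_card hES
    rw [one_pow, one_mul, ← pow_add]
    congr 1
    omega

theorem toFinset_subset_of_mem_edgesOn {V : Finset W} {e : Sym2 W} (he : e ∈ edgesOn V) :
    e.toFinset ⊆ V ∧ e.toFinset.card = 2 := by
  induction e with | _ a b =>
  obtain ⟨ha, hb, hab⟩ := mk_mem_edgesOn.1 he
  rw [Sym2.toFinset_mk_eq]
  exact ⟨by simp [Finset.insert_subset_iff, ha, hb], Finset.card_pair hab⟩

/-- Double counting: `|S|` counts the elements of `S`, and `e` is full in `S` exactly when `e ⊆ S ⊆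
e ∪ N e`. In each case `sum_pow_between` evaluates the sum over `S`. -/
theorem sum_card_add_one_add_card_fullEdges (q : ℕ) {V : Finset W} {N : Sym2 W → Finset W}
    (hN : ∀ e ∈ edgesOn V, N e ⊆ V ∧ ∀ w ∈ N e, w ∉ e) :
    ∑ S ∈ V.powerset, (S.card + 1 + (fullEdges N S).card) * q ^ (V.card - S.card) =
      (q + 1) ^ V.card + V.card * (q + 1) ^ (V.card - 1) +
        ∑ e ∈ edgesOn V, q ^ (V.card - 2 - (N e).card) * (q + 1) ^ (N e).card := by
  have h₁ : ∑ S ∈ V.powerset, q ^ (V.card - S.card) = (q + 1) ^ V.card := by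
    have := sum_pow_between q (Finset.empty_subset V) subset_rfl (Finset.disjoint_empty_left V)
    rw [Finset.filter_true_of_mem fun S hS =>
      ⟨Finset.empty_subset S, Finset.sdiff_subset.trans (Finset.mem_powerset.1 hS)⟩] at this
    simpa using this
  have h₂ : ∑ S ∈ V.powerset, S.card * q ^ (V.card - S.card) =
      V.card * (q + 1) ^ (V.card - 1) := by
    have hterm : ∀ i ∈ V, ∑ S ∈ V.powerset with i ∈ S, q ^ (V.card - S.card) =
        (q + 1) ^ (V.card - 1) := by
      intro i hi
      have := sum_pow_between q (Finset.singleton_subset_iff.2 hi) (Finset.erase_subset i V)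
        (by simp)
      rw [Finset.card_singleton, Finset.card_erase_of_mem hi, Nat.sub_self, pow_zero,
        one_mul] at this
      rw [← this]
      refine Finset.sum_congr (Finset.filter_congr fun S hS => ?_) fun _ _ => rfl
      have := Finset.mem_powerset.1 hS
      simp only [Finset.singleton_subset_iff, iff_self_and]
      intro _
      rw [Finset.sdiff_singleton_eq_erase]
      exact Finset.erase_subset_erase i this
    rw [← smul_eq_mul (V.card), ← Finset.sum_const, ← Finset.sum_congr rfl hterm]
    simp only [Finset.sum_filter]
    rw [Finset.sum_comm]
    refine Finset.sum_congr rfl fun S hS => ?_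
    rw [← Finset.sum_filter, Finset.filter_mem_eq_inter,
      Finset.inter_eq_right.2 (Finset.mem_powerset.1 hS), Finset.sum_const, smul_eq_mul]
  have h₃ : ∑ S ∈ V.powerset, (fullEdges N S).card * q ^ (V.card - S.card) =
      ∑ e ∈ edgesOn V, q ^ (V.card - 2 - (N e).card) * (q + 1) ^ (N e).card := by
    have hterm : ∀ e ∈ edgesOn V, ∑ S ∈ V.powerset with e ∈ fullEdges N S, q ^ (V.card - S.card) =
        q ^ (V.card - 2 - (N e).card) * (q + 1) ^ (N e).card := by
      intro e he
      obtain ⟨heV, he2⟩ := toFinset_subset_of_mem_edgesOn he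
      obtain ⟨hNV, hNe⟩ := hN e he
      have := sum_pow_between q heV hNV (Finset.disjoint_left.2 fun w hw hw' =>
        hNe w hw' (Sym2.mem_toFinset.1 hw))
      rw [he2] at this
      rw [← this]
      refine Finset.sum_congr (Finset.filter_congr fun S hS => ?_) fun _ _ => rfl
      rw [fullEdges, Finset.mem_filter]
      refine and_congr ?_ ?_
      · induction e with | _ a b =>
        have := mk_mem_edgesOn.1 he
        rw [mk_mem_edgesOn, Sym2.toFinset_mk_eq]
        simp [Finset.insert_subset_iff, this.2.2]
      · simp only [Finset.subset_iff, Finset.mem_sdiff, Sym2.mem_toFinset, and_imp]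
    rw [← Finset.sum_congr rfl hterm]
    simp only [Finset.sum_filter]
    rw [Finset.sum_comm]
    refine Finset.sum_congr rfl fun S hS => ?_
    have hsub : fullEdges N S ⊆ edgesOn V := by
      refine (Finset.filter_subset _ _).trans fun e => ?_
      have := Finset.mem_powerset.1 hS
      induction e with | _ a b =>
      rw [mk_mem_edgesOn, mk_mem_edgesOn]
      exact fun h => ⟨this h.1, this h.2.1, h.2.2⟩
    rw [← Finset.sum_filter, Finset.filter_mem_eq_inter, Finset.inter_eq_right.2 hsub,
      Finset.sum_const, smul_eq_mul]
  rw [← h₁, ← h₂, ← h₃, ← Finset.sum_add_distrib, ← Finset.sum_add_distrib]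
  exact Finset.sum_congr rfl fun S _ => by ring

/-- Termwise, `((q + 1) / q) ^ k * q ^ (|V| - 2) = q ^ (|V| - 2 - k) * (q + 1) ^ k`. The truncated
subtractions are harmless because `e` and `N e` are disjoint in `V`, so `k + 2 ≤ |V|`. -/
theorem weight_mul_zpow {V : Finset W} {G : Multiset (Sym2 W)} {N : Sym2 W → Finset W}
    (hN : ∀ e ∈ edgesOn V, N e ⊆ V ∧ (∀ w ∈ N e, w ∉ e) ∧ (N e).card = G.count e)
    {q : ℕ} (hq : 0 < q) :
    weight V G (((q : ℝ) + 1) / q) * (q : ℝ) ^ ((V.card : ℤ) - 2) =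
      ((∑ e ∈ edgesOn V, q ^ (V.card - 2 - (N e).card) * (q + 1) ^ (N e).card : ℕ) : ℝ) := by
  have hq' : (q : ℝ) ≠ 0 := by positivity
  rw [weight, Finset.sum_mul, Nat.cast_sum]
  refine Finset.sum_congr rfl fun e he => ?_
  obtain ⟨hNV, hNe, hNc⟩ := hN e he
  obtain ⟨heV, he2⟩ := toFinset_subset_of_mem_edgesOn he
  have hle : (N e).card + 2 ≤ V.card := by
    rw [← he2, ← Finset.card_union_of_disjoint (Finset.disjoint_left.2 fun w hw hw' =>
      hNe w hw (Sym2.mem_toFinset.1 hw'))]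
    exact Finset.card_le_card (Finset.union_subset hNV heV)
  obtain ⟨d, hd⟩ := Nat.exists_eq_add_of_le hle
  have hz : ((V.card : ℤ) - 2) = (((N e).card + d : ℕ) : ℤ) := by rw [hd]; push_cast; ring
  rw [hz, zpow_natCast, ← hNc, show V.card - 2 - (N e).card = d by omega, div_pow, pow_add]
  push_cast
  field_simp

end Counting

/-! ### Matrices as sets of columns, sorted by their rows with entries `0` and `1`. -/

section Columns

variable {m r : ℕ}

/-- The rows in which a column has a `0` or a `1`. -/
def lowRows (x : Fin m → Fin r) : Finset (Fin m) := Finset.univ.filter fun i => (x i).val ≤ 1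

/-- The rows in which a column has a `1`. -/
def oneRows (x : Fin m → Fin r) : Finset (Fin m) := Finset.univ.filter fun i => (x i).val = 1

theorem mem_lowRows {x : Fin m → Fin r} {i : Fin m} : i ∈ lowRows x ↔ (x i).val ≤ 1 := by
  simp [lowRows]

theorem mem_oneRows {x : Fin m → Fin r} {i : Fin m} : i ∈ oneRows x ↔ (x i).val = 1 := by
  simp [oneRows]

theorem oneRows_subset_lowRows (x : Fin m → Fin r) : oneRows x ⊆ lowRows x := fun _ hi =>
  mem_lowRows.2 (mem_oneRows.1 hi).le

theorem card_columns_of_rows (hr : 3 ≤ r) {S A : Finset (Fin m)}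
    (hA : A ⊆ S) :
    (Finset.univ.filter fun x : Fin m → Fin r => lowRows x = S ∧ oneRows x = A).card =
      (r - 2) ^ (m - S.card) := by
  set v₀ : Fin r := ⟨0, by omega⟩
  set v₁ : Fin r := ⟨1, by omega⟩
  set v₂ : Fin r := ⟨2, by omega⟩
  have hv₀ : v₀.val = 0 := rfl
  have hv₁ : v₁.val = 1 := rfl
  have hv₂ : v₂.val = 2 := rfl
  have h : (Finset.univ.filter fun x : Fin m → Fin r => lowRows x = S ∧ oneRows x = A) =
      Fintype.piFinset fun i =>
        if i ∈ S then (if i ∈ A then {v₁} else {v₀}) else Finset.Ici v₂ := by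
    ext x
    simp only [Finset.mem_filter, Finset.mem_univ, true_and, Fintype.mem_piFinset,
      Finset.ext_iff, mem_lowRows, mem_oneRows, ← forall_and]
    refine forall_congr' fun i => ?_
    have := @hA i
    by_cases hS : i ∈ S <;> by_cases hA' : i ∈ A
    · simp only [hS, hA', if_true, Finset.mem_singleton, Fin.ext_iff, hv₁, iff_true]
      omega
    · simp only [hS, hA', if_true, if_false, Finset.mem_singleton, Fin.ext_iff, hv₀, iff_true, iff_false]
      omega
    · exact absurd (this hA') hS
    · simp only [hS, hA', if_false, Finset.mem_Ici, Fin.le_def, hv₂, iff_false]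
      omega
  rw [h, Fintype.card_piFinset]
  have : ∀ i, (if i ∈ S then (if i ∈ A then {v₁} else {v₀}) else Finset.Ici v₂).card =
      if i ∈ S then 1 else r - 2 := by
    intro i
    split_ifs <;> simp [hv₂]
  rw [Finset.prod_congr rfl fun i _ => this i, Finset.prod_ite, Finset.prod_const_one, one_mul,
    Finset.prod_const, Finset.filter_not, Finset.card_sdiff_of_subset (Finset.filter_subset _ _)]
  simp

theorem card_columns (hr : 3 ≤ r) (𝓐 : Finset (Fin m) → Finset (Finset (Fin m)))
    (h𝓐 : ∀ S, ∀ A ∈ 𝓐 S, A ⊆ S) :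
    (Finset.univ.filter fun x : Fin m → Fin r => oneRows x ∈ 𝓐 (lowRows x)).card =
      ∑ S ∈ Finset.univ.powerset, (𝓐 S).card * (r - 2) ^ (m - S.card) := by
  rw [Finset.card_eq_sum_card_fiberwise (f := lowRows) (t := Finset.univ.powerset)
    fun x _ => by simp]
  refine Finset.sum_congr rfl fun S _ => ?_
  rw [Finset.card_eq_sum_card_fiberwise (f := oneRows) (t := 𝓐 S) (by
    intro x hx
    simp only [Finset.coe_filter, Finset.mem_filter, Set.mem_ofPred_eq] at hx
    exact hx.2 ▸ hx.1.2)]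
  rw [Finset.sum_congr rfl fun A hA => ?_, Finset.sum_const, smul_eq_mul]
  rw [← card_columns_of_rows hr (h𝓐 S A hA)]
  congr 1
  ext x
  simp only [Finset.mem_filter, Finset.mem_univ, true_and]
  constructor
  · rintro ⟨⟨-, h₁⟩, h₂⟩
    exact ⟨h₁, h₂⟩
  · rintro ⟨rfl, rfl⟩
    exact ⟨⟨hA, rfl⟩, rfl⟩

/-- No two columns of `𝓒` contain `M`. -/
def AvoidsM (𝓒 : Finset (Fin m → Fin r)) : Prop :=
  ∀ x ∈ 𝓒, ∀ y ∈ 𝓒, ∀ i j k, i ≠ j →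
    (x i).val = 0 → (x j).val = 0 → (x k).val = 1 →
      (y i).val = 1 → (y j).val = 1 → (y k).val = 0 → False

theorem AvoidsM.card_le_forb {𝓒 : Finset (Fin m → Fin r)} (h : AvoidsM 𝓒) :
    𝓒.card ≤ forb m r M := by
  refine (forb_isGreatest m r (by norm_num) M).2
    ⟨fun i j => ((𝓒.equivFin.symm j).1 i).val, fun i j => ((𝓒.equivFin.symm j).1 i).2, ?_, ?_⟩
  · intro j j' hj
    exact 𝓒.equivFin.symm.injective (Subtype.ext (funext fun i => Fin.ext (hj i)))
  · rintro ⟨f, g, hf, -, hfg⟩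
    exact h _ (𝓒.equivFin.symm (g 0)).2 _ (𝓒.equivFin.symm (g 1)).2 (f 0) (f 1) (f 2)
      (hf.ne (by decide)) (hfg 0 0) (hfg 1 0) (hfg 2 0) (hfg 0 1) (hfg 1 1) (hfg 2 1)

theorem exists_avoidsM_card_eq_forb (m r : ℕ) :
    ∃ 𝓒 : Finset (Fin m → Fin r), AvoidsM 𝓒 ∧ 𝓒.card = forb m r M := by
  classical
  obtain ⟨A, hA, hs, hM⟩ := (forb_isGreatest m r (by norm_num) M).1
  refine ⟨Finset.univ.image fun j i => (⟨A i j, hA i j⟩ : Fin r), ?_, ?_⟩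
  · intro x hx y hy i j k hij h₁ h₂ h₃ h₄ h₅ h₆
    obtain ⟨a, -, rfl⟩ := Finset.mem_image.1 hx
    obtain ⟨b, -, rfl⟩ := Finset.mem_image.1 hy
    simp only at h₁ h₂ h₃ h₄ h₅ h₆
    -- `AvoidsM` only asks for `i ≠ j`; the entries force the other rows and the two columns to be
    -- distinct.
    have hab : a ≠ b := by rintro rfl; omega
    have hik : i ≠ k := by rintro rfl; omega
    have hjk : j ≠ k := by rintro rfl; omega
    refine hM ⟨![i, j, k], ![a, b], ?_, ?_, ?_⟩
    · intro s t hst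
      fin_cases s <;> fin_cases t <;> simp_all
    · intro s t hst
      fin_cases s <;> fin_cases t <;> simp_all
    · intro s t
      fin_cases s <;> fin_cases t <;> simp [M, *]
  · rw [Finset.card_image_of_injective, Finset.card_univ, Fintype.card_fin]
    intro j j' hj
    exact hs j j' fun i => congrArg Fin.val (congrFun hj i)

end Columns

/-! ### The TCM determined by `D` and a rank. -/

section DistinguishedTCM

variable {W : Type*} {D : W → W → W → Prop} {ρ : W → ℕ}

theorem Distinguished.swap (hD : ∀ x y z, D x y z ↔ D x z y) {a b w : W}
    (h : Distinguished D ρ a b w) : Distinguished D ρ b a w := by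
  have h₁ := hD w a b
  unfold Distinguished at *
  tauto

/-- With `swap` and `exists_distinguished`, this makes exactly one element of each triple
distinguished, so the triple has a well-defined chosen edge. -/
theorem Distinguished.not_rotate (hD : ∀ x y z, D x y z ↔ D x z y) {a b w : W}
    (h : Distinguished D ρ a b w) : ¬ Distinguished D ρ w b a := by
  have h₁ := hD a b w
  have h₂ := hD b a w
  have h₃ := hD w a b
  unfold Distinguished at *
  have h₄ : ρ a < ρ w → ¬ ρ w < ρ a := fun h h' => lt_asymm h h'
  tauto

theorem exists_distinguished (hD : ∀ x y z, D x y z ↔ D x z y) (hρ : Function.Injective ρ)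
    {a b w : W} (hab : a ≠ b) (haw : a ≠ w) (hbw : b ≠ w) :
    Distinguished D ρ a b w ∨ Distinguished D ρ w b a ∨ Distinguished D ρ a w b := by
  have h₁ := hD a b w
  have h₂ := hD b a w
  have h₃ := hD w a b
  have h₄ := hρ.ne hab
  have h₅ := hρ.ne haw
  have h₆ := hρ.ne hbw
  have h₇ : (ρ a < ρ w ∧ ρ b < ρ w) ∨ (ρ w < ρ a ∧ ρ b < ρ a) ∨ (ρ a < ρ b ∧ ρ w < ρ b) := by
    omega
  unfold Distinguished
  rw [← h₁, ← h₂, ← h₃]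
  by_cases p₁ : D a b w <;> by_cases p₂ : D b a w <;> by_cases p₃ : D w a b <;>
    simp only [p₁, p₂, p₃, not_true, not_false_iff, true_and, false_and, and_self,
      or_true, false_or, or_false, iff_self, iff_true, iff_false] <;> omega

variable [DecidableEq W]

theorem exists_edge_of_distinguished (hD : ∀ x y z, D x y z ↔ D x z y)
    (hρ : Function.Injective ρ) {T : Finset W} (hT : T.card = 3) :
    ∃ e ∈ edgesOn T, ∀ a b w, T = {a, b, w} → a ≠ b → a ≠ w → b ≠ w →
      Distinguished D ρ a b w → e = s(a, b) := by
  obtain ⟨x, y, z, hxy, hxz, hyz, hd, rfl⟩ : ∃ x y z : W, x ≠ y ∧ x ≠ z ∧ y ≠ z ∧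
      Distinguished D ρ x y z ∧ T = {x, y, z} := by
    obtain ⟨x, y, z, hxy, hxz, hyz, rfl⟩ := Finset.card_eq_three.1 hT
    rcases exists_distinguished hD hρ hxy hxz hyz with h | h | h
    · exact ⟨x, y, z, hxy, hxz, hyz, h, rfl⟩
    · exact ⟨z, y, x, hyz.symm, hxz.symm, hxy.symm, h, by ext; simp; tauto⟩
    · exact ⟨x, z, y, hxz, hxy, hyz.symm, h, by ext; simp; tauto⟩
  refine ⟨s(x, y), mk_mem_edgesOn.2 ⟨by simp, by simp, hxy⟩, fun a b w h hab haw hbw hd' => ?_⟩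
  have hn₁ := hd.not_rotate hD
  have hn₂ := (hd.swap hD).not_rotate hD
  have h' := Finset.ext_iff.1 h
  simp only [Finset.mem_insert, Finset.mem_singleton] at h'
  have ha := (h' a).2 (.inl rfl)
  have hb := (h' b).2 (.inr (.inl rfl))
  have hw := (h' w).2 (.inr (.inr rfl))
  have hds := hd'.swap hD
  rw [Sym2.eq_iff]
  clear h h'
  rcases hw with rfl | rfl | rfl <;> rcases ha with rfl | rfl | rfl <;>
    rcases hb with rfl | rfl | rfl <;> first | contradiction | simp

theorem exists_isTCM_of_distinguished [Nonempty W] (hD : ∀ x y z, D x y z ↔ D x z y)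
    (hρ : Function.Injective ρ) (V : Finset W) :
    ∃ (G : Multiset (Sym2 W)) (N : Sym2 W → Finset W), IsTCM V G ∧
      (∀ e ∈ edgesOn V, N e ⊆ V ∧ (∀ w ∈ N e, w ∉ e) ∧ (N e).card = G.count e) ∧
      ∀ a ∈ V, ∀ b ∈ V, ∀ w ∈ V, a ≠ b → a ≠ w → b ≠ w → Distinguished D ρ a b w →
        w ∈ N s(a, b) := by
  classical
  have hex : ∀ T : Finset W, ∃ e, T.card = 3 → e ∈ edgesOn T ∧
      ∀ a b w, T = {a, b, w} → a ≠ b → a ≠ w → b ≠ w → Distinguished D ρ a b w → e = s(a, b) := by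
    intro T
    by_cases hT : T.card = 3
    · obtain ⟨e, he, h⟩ := exists_edge_of_distinguished hD hρ hT
      exact ⟨e, fun _ => ⟨he, h⟩⟩
    · exact ⟨s(Classical.arbitrary W, Classical.arbitrary W), fun h => absurd h hT⟩
  choose c hc using hex
  refine ⟨(V.powersetCard 3).val.map c,
    -- The map from `w` to the triple `e ∪ {w}` is a bijection from `N e` onto the triples that
    -- choose `e`, so `|N e|` is the multiplicity of `e`.
    fun e => V.filter fun w => w ∉ e ∧ c (insert w e.toFinset) = e, ?_, ?_, ?_⟩
  · exact isTCM_iff.2 ⟨c, fun T hT => (hc T (Finset.mem_powersetCard.1 hT).2).1, rfl⟩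
  · intro e he
    refine ⟨Finset.filter_subset _ _, fun w hw => (Finset.mem_filter.1 hw).2.1, ?_⟩
    obtain ⟨heV, he2⟩ := toFinset_subset_of_mem_edgesOn he
    rw [Multiset.count_map]
    change _ = ((V.powersetCard 3).filter fun T => e = c T).card
    refine Finset.card_bij (fun w _ => insert w e.toFinset) ?_ ?_ ?_
    · intro w hw
      obtain ⟨hwV, hwe, hcw⟩ := Finset.mem_filter.1 hw
      rw [Finset.mem_filter, Finset.mem_powersetCard]
      refine ⟨⟨Finset.insert_subset hwV heV, ?_⟩, hcw.symm⟩
      rw [Finset.card_insert_of_notMem (by rwa [Sym2.mem_toFinset]), he2]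
    · intro w hw w' hw' h
      have hwe := (Finset.mem_filter.1 hw).2.1
      have : w ∈ insert w' e.toFinset := h ▸ Finset.mem_insert_self _ _
      rw [Finset.mem_insert, Sym2.mem_toFinset] at this
      exact this.resolve_right hwe
    · intro T hT
      rw [Finset.mem_filter, Finset.mem_powersetCard] at hT
      obtain ⟨⟨hTV, hT3⟩, hcT⟩ := hT
      have heT := (toFinset_subset_of_mem_edgesOn (hcT ▸ (hc T hT3).1)).1
      have h1 : (T \ e.toFinset).card = 1 := by
        rw [Finset.card_sdiff_of_subset heT, hT3, he2]
      obtain ⟨w, hw⟩ := Finset.card_eq_one.1 h1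
      obtain ⟨hwT, hwe⟩ := Finset.mem_sdiff.1 (hw.symm ▸ Finset.mem_singleton_self w)
      have hins : insert w e.toFinset = T := by
        rw [← Finset.sdiff_union_of_subset heT, hw]
        rfl
      rw [Sym2.mem_toFinset] at hwe
      exact ⟨w, Finset.mem_filter.2 ⟨hTV hwT, hwe, by rw [hins, ← hcT]⟩, hins⟩
  · intro a ha b hb w hw hab haw hbw hd
    rw [Finset.mem_filter]
    have hT : insert w s(a, b).toFinset = {a, b, w} := by
      ext
      simp only [Sym2.toFinset_mk_eq, Finset.mem_insert, Finset.mem_singleton]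
      tauto
    refine ⟨hw, ?_, ?_⟩
    · rw [Sym2.mem_iff]
      rintro (h | h)
      · exact haw h.symm
      · exact hbw h.symm
    · rw [hT]
      refine (hc _ ?_).2 a b w rfl hab haw hbw hd
      exact Finset.card_eq_three.2 ⟨a, b, w, hab, haw, hbw, rfl⟩

end DistinguishedTCM

/-! ### The two inequalities for `forb`. -/

section Bounds

variable {m q : ℕ}

theorem le_forb_of_isTwoRecursive (hq : 0 < q) {G : Multiset (Sym2 (Fin m))}
    (hG : IsTwoRecursive Finset.univ G) :
    ((q : ℝ) + 1) ^ m + m * ((q : ℝ) + 1) ^ (m - 1) +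
      weight Finset.univ G (((q : ℝ) + 1) / q) * (q : ℝ) ^ ((m : ℤ) - 2) ≤ forb m (q + 2) M := by
  classical
  obtain ⟨D, N, hN, hS⟩ := hG.exists_admissibleSets
  have hw := weight_mul_zpow hN hq
  have hsum := sum_card_add_one_add_card_fullEdges q fun e he => ⟨(hN e he).1, (hN e he).2.1⟩
  have hcol := card_columns (m := m) (r := q + 2) (by omega) (admissibleSets D)
    fun S A hA => (mem_admissibleSets.1 hA).1
  rw [Finset.card_univ, Fintype.card_fin] at hw hsum
  have havoid : AvoidsM (Finset.univ.filter fun x : Fin m → Fin (q + 2) =>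
      oneRows x ∈ admissibleSets D (lowRows x)) := by
    intro x hx y hy i j k hij h₁ h₂ h₃ h₄ h₅ h₆
    have hx := (mem_admissibleSets.1 (Finset.mem_filter.1 hx).2).2
    have hy := (mem_admissibleSets.1 (Finset.mem_filter.1 hy).2).2
    simp only [mem_lowRows, mem_oneRows] at hx hy
    have hki : k ≠ i := by rintro rfl; omega
    have hkj : k ≠ j := by rintro rfl; omega
    -- The two columns may have different sets `lowRows`, but both contain `i, j, k`, and the same
    -- `D` governs all of them: the first column refutes `D k i j` and the second proves it.
    exact (hx k (by omega) i (by omega) j (by omega) hki hkj hij).1 h₃ (by omega) (by omega)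
      ((hy k (by omega) i (by omega) j (by omega) hki hkj hij).2 (by omega) h₄ h₅)
  have hle : (q + 1) ^ m + m * (q + 1) ^ (m - 1) +
      ∑ e ∈ edgesOn Finset.univ, q ^ (m - 2 - (N e).card) * (q + 1) ^ (N e).card ≤
        forb m (q + 2) M := by
    rw [← hsum]
    refine le_trans ?_ havoid.card_le_forb
    rw [hcol]
    exact Finset.sum_le_sum fun S _ => Nat.mul_le_mul_right _ (hS S (Finset.subset_univ S))
  rw [hw]
  exact_mod_cast hle

theorem forb_le_of_isTCM (hm : 0 < m) (hq : 0 < q) :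
    ∃ G : Multiset (Sym2 (Fin m)), IsTCM Finset.univ G ∧
      (forb m (q + 2) M : ℝ) ≤ ((q : ℝ) + 1) ^ m + m * ((q : ℝ) + 1) ^ (m - 1) +
        weight Finset.univ G (((q : ℝ) + 1) / q) * (q : ℝ) ^ ((m : ℤ) - 2) := by
  classical
  have : Nonempty (Fin m) := ⟨⟨0, hm⟩⟩
  obtain ⟨𝓒, h𝓒, hcard⟩ := exists_avoidsM_card_eq_forb m (q + 2)
  -- `D` records which patterns `0, 1, 1` occur in an optimal family. Half of admissibility then
  -- holds by definition, and the other half is avoidance of `M`.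
  set D : Fin m → Fin m → Fin m → Prop := fun x y z =>
    ∃ c ∈ 𝓒, (c x).val = 0 ∧ (c y).val = 1 ∧ (c z).val = 1
  have hD : ∀ x y z, D x y z ↔ D x z y := by
    intro x y z
    exact exists_congr fun c => and_congr_right fun _ => and_congr_right fun _ => and_comm
  obtain ⟨G, N, hG, hN, hdist⟩ :=
    exists_isTCM_of_distinguished (ρ := Fin.val) hD Fin.val_injective Finset.univ
  refine ⟨G, hG, ?_⟩
  have hw := weight_mul_zpow hN hq
  have hsum := sum_card_add_one_add_card_fullEdges q fun e he => ⟨(hN e he).1, (hN e he).2.1⟩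
  have hcol := card_columns (m := m) (r := q + 2) (by omega) (admissibleSets D)
    fun S A hA => (mem_admissibleSets.1 hA).1
  rw [Finset.card_univ, Fintype.card_fin] at hw hsum
  have hsub : 𝓒 ⊆ Finset.univ.filter fun x : Fin m → Fin (q + 2) =>
      oneRows x ∈ admissibleSets D (lowRows x) := by
    intro c hc
    rw [Finset.mem_filter, mem_admissibleSets]
    refine ⟨Finset.mem_univ _, oneRows_subset_lowRows c, fun x hx y hy z hz hxy hxz hyz => ?_⟩
    simp only [mem_lowRows, mem_oneRows] at *
    constructor
    · rintro h₁ h₂ h₃ ⟨c', hc', h₄, h₅, h₆⟩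
      exact h𝓒 c hc c' hc' y z x hyz (by omega) (by omega) h₁ h₅ h₆ h₄
    · intro h₁ h₂ h₃
      exact ⟨c, hc, by omega, h₂, h₃⟩
  have hle : forb m (q + 2) M ≤ (q + 1) ^ m + m * (q + 1) ^ (m - 1) +
      ∑ e ∈ edgesOn Finset.univ, q ^ (m - 2 - (N e).card) * (q + 1) ^ (N e).card := by
    rw [← hsum, ← hcard]
    refine (Finset.card_le_card hsub).trans ?_
    rw [hcol]
    exact Finset.sum_le_sum fun S _ => Nat.mul_le_mul_right _
      (card_admissibleSets_le Fin.val_injective fun a _ b _ w _ =>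
        hdist a (Finset.mem_univ a) b (Finset.mem_univ b) w (Finset.mem_univ w))
  rw [hw]
  exact_mod_cast hle

theorem forb_zero_left (r : ℕ) : forb 0 r M = 1 := by
  refine le_antisymm ?_ ?_
  · obtain ⟨A, -, hs, -⟩ := (forb_isGreatest 0 r (by norm_num) M).1
    by_contra h
    exact absurd (hs ⟨0, by omega⟩ ⟨1, by omega⟩ fun i => i.elim0) (by simp)
  · exact (forb_isGreatest 0 r (by norm_num) M).2
      ⟨fun i => i.elim0, fun i => i.elim0, fun j j' _ => Subsingleton.elim j j',
        fun ⟨f, _⟩ => (f 0).elim0⟩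

theorem H_zero_left (α : ℝ) : H 0 α = 0 := by
  obtain ⟨G, -, hG⟩ := (H_isGreatest 0 α).1
  rw [hG, weight, show edgesOn (Finset.univ : Finset (Fin 0)) = ∅ from rfl, Finset.sum_empty]

theorem H₂_zero_left (α : ℝ) : H₂ 0 α = 0 := by
  obtain ⟨G, -, hG⟩ := (H₂_isGreatest 0 α).1
  rw [hG, weight, show edgesOn (Finset.univ : Finset (Fin 0)) = ∅ from rfl, Finset.sum_empty]

end Bounds
end ForbConfig

theorem mainTheorem1 (m r : ℕ) (hr : 3 ≤ r) :
    ForbConfig.H₂ m (((r : ℝ) - 1) / ((r : ℝ) - 2)) * ((r : ℝ) - 2) ^ ((m : ℤ) - 2) ≤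
        (ForbConfig.forb m r ForbConfig.M : ℝ) - ((r : ℝ) - 1) ^ m
          - (m : ℝ) * ((r : ℝ) - 1) ^ ((m : ℤ) - 1) ∧
      (ForbConfig.forb m r ForbConfig.M : ℝ) - ((r : ℝ) - 1) ^ m
          - (m : ℝ) * ((r : ℝ) - 1) ^ ((m : ℤ) - 1) ≤
        ForbConfig.H m (((r : ℝ) - 1) / ((r : ℝ) - 2)) * ((r : ℝ) - 2) ^ ((m : ℤ) - 2) := by
  -- For `m = 0` both sides vanish: the empty column is the only one, and there are no edges. For `m
  -- > 0` the integer exponent `m - 1` is a natural number.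
  rcases Nat.eq_zero_or_pos m with rfl | hm
  · simp [ForbConfig.forb_zero_left, ForbConfig.H_zero_left, ForbConfig.H₂_zero_left]
  obtain ⟨q, rfl⟩ : ∃ q, r = q + 2 := ⟨r - 2, by omega⟩
  have hq : 0 < q := by omega
  have e₁ : ((q + 2 : ℕ) : ℝ) - 1 = q + 1 := by push_cast; ring
  have e₂ : ((q + 2 : ℕ) : ℝ) - 2 = q := by push_cast; ring
  have e₃ : ((m : ℤ) - 1) = ((m - 1 : ℕ) : ℤ) := by omega
  rw [e₁, e₂, e₃, zpow_natCast]
  constructor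
  · obtain ⟨G, hG, hH⟩ := (ForbConfig.H₂_isGreatest m (((q : ℝ) + 1) / q)).1
    have := ForbConfig.le_forb_of_isTwoRecursive hq hG
    rw [hH]
    linarith
  · obtain ⟨G, hG, hle⟩ := ForbConfig.forb_le_of_isTCM hm hq
    have hH := (ForbConfig.H_isGreatest m (((q : ℝ) + 1) / q)).2 ⟨G, hG, rfl⟩
    have := mul_le_mul_of_nonneg_right hH (zpow_nonneg (Nat.cast_nonneg (α := ℝ) q) ((m : ℤ) - 2))
    linarith
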